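/- Let $\mathbb{T}=\mathbb{R}\cup\{-\infty\}$ be the tropical semifield (addition is $\max$, multiplication is $+_{\mathbb{R}}$); for $a\in\mathbb{T}$ write $\log a\in\mathbb{R}\cup\{-\infty\}$ for the underlying element, so $\log 0_{\mathbb{T}}=-\infty$. Let $S\subseteq\mathbb{T}$ be a sub-semifield different from the Boolean semifield $\{0_{\mathbb T},1_{\mathbb T}\}$, and let $\Gamma=\log(S^\times)\subseteq\mathbb{R}$. Let $M$ be a finitely generated free abelian group, $N_{\mathbb{R}}=\operatorname{Hom}(M,\mathbb{R})$ with pairing $\langle x,u\rangle=x(u)$, and let $S[M]$ be the monoid algebra, with terms $a\chi^u$ ($a\in S$, $u\in M$). *Prime congruences.* An additively idempotent semiring is ordered by $a\le b\iff a+b=b$. A congruence $P$ on a semiring $A$ is prime if it is proper and $A/P$ is totally ordered and cancellative (if $xy=xz$ and $x\neq0$ then $y=z$). Let $\kappa(P)$ be the total semiring of fractions of $A/P$, let $f\mapsto|f|_P$ be the map $A\to\kappa(P)$, and write $f\le_P g$ if the class of $f$ is at most the class of $g$ in $A/P$. A totally ordered semifield carries the topology in which all nonzero points are isolated and the sets $\{x: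 x<c\}$, $c\ne0$, form a neighbourhood basis of $0$. Let $\operatorname{Cont}_S S[M]$ be the set of prime congruences $P$ on $S[M]$ such that $S[M]/P$ is not finite and $S\to S[M]\to\kappa(P)$ is continuous. *Polyhedra and cones.* A $\Gamma$-rational polyhedron is a set $\{x\in N_{\mathbb{R}}:\langle x,u_i\rangle\le\gamma_i,\ 1\le i\le q\}$ with $u_i\in M$, $\gamma_i\in\Gamma$; it is a polytope if it is bounded. A $\Gamma$-admissible cone is a set $\{(r,x)\in\mathbb{R}_{\ge0}\times N_{\mathbb{R}}: r\gamma_i+\langle x,u_i\rangle\le0,\ 1\le i\le q\}$ with $u_i\in M$, $\gamma_i\in\Gamma$. A $\Gamma$-rational polyhedral set is a finite (possibly empty) union of $\Gamma$-rational polyhedra, and a $\Gamma$-admissible fan support set is a finite (possibly empty) union of $\Gamma$-admissible cones. Both kinds of sets form lattices under $\cap$ and $\cup$. Prime filters on a lattice are nonempty and proper. *Filters.* For $f=\sum_u f_u\chi^u\in S[M]$ put $f(x)=\max_u(\log f_u+\langle x,u\rangle)$ and $\widetilde f(r,x)=\max_u(r\log f_u+\langle x,u\rangle)$, the maxima being over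 the $u$ with $f_u\neq0$, and $-\infty$ if $f=0$. Put $R(f_0,\dots,f_n)=\{x\in N_{\mathbb{R}}:f_0(x)\ge f_i(x),\ 1\le i\le n\}$ and $\widetilde R(f_0,\dots,f_n)=\{w\in\mathbb{R}_{\ge0}\times N_{\mathbb{R}}:\widetilde f_0(w)\ge\widetilde f_i(w),\ 1\le i\le n\}$. For a prime congruence $P$ on $S[M]$ let $\widetilde{\mathcal F}_P$ be the set of $\Gamma$-admissible fan support sets $\widetilde U$ for which there are $f_0,\dots,f_n\in S[M]$ with $\widetilde R(f_0,\dots,f_n)\subseteq\widetilde U$ and $f_i\le_P f_0$ for $1\le i\le n$; for $P\in\operatorname{Cont}_S S[M]$ let $\mathcal F_P$ be the set of $\Gamma$-rational polyhedral sets $U$ for which there are $f_0,\dots,f_n\in S[M]$ with $R(f_0,\dots,f_n)\subseteq U$ and $f_i\le_P f_0$ for $1\le i\le n$. For a filter $\widetilde{\mathcal F}$ of $\Gamma$-admissible fan support sets, write $a\chi^u\le_{\widetilde{\mathcal F}}b\chi^\lambda$ if $\widetilde U\subseteq\widetilde R(b\chi^\lambda,a\chi^u)$ for some $\widetilde U\in\widetilde{\mathcal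 F}$; for a filter $\mathcal F$ of $\Gamma$-rational polyhedral sets, write $a\chi^u\le_{\mathcal F}b\chi^\lambda$ if $U\subseteq R(b\chi^\lambda,a\chi^u)$ for some $U\in\mathcal F$. **Theorem.** (1) The map $P\mapsto\widetilde{\mathcal F}_P$ is a bijection from the set of prime congruences on $S[M]$ to the set of prime filters on the lattice of $\Gamma$-admissible fan support sets. Its inverse sends $\widetilde{\mathcal F}$ to the unique prime congruence $P$ on $S[M]$ such that $\le_P$ and $\le_{\widetilde{\mathcal F}}$ coincide on terms. (2) The map $P\mapsto\mathcal F_P$ is a bijection from $\operatorname{Cont}_S S[M]$ to the set of prime filters on the lattice of $\Gamma$-rational polyhedral sets that contain a polytope. Its inverse sends $\mathcal F$ to the unique $P\in\operatorname{Cont}_S S[M]$ such that $\le_P$ and $\le_{\mathcal F}$ coincide on terms. -/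

import Mathlib

open scoped NNReal

namespace TropFilter

/-! ### Idempotent semirings, the tropical semifield and its sub-semifields -/

/-- The canonical order of an additively idempotent semiring: `a ≤ b` iff `a + b = b`. -/
def IdemLE {R : Type*} [Add R] (a b : R) : Prop := a + b = b

/-- The strict version of the canonical order. -/
def IdemLT {R : Type*} [Add R] (a b : R) : Prop := a + b = b ∧ a ≠ b

/-- The tropical semifield `𝕋` on `ℝ ∪ {-∞}`: addition is the maximum, multiplication is the
usual addition. Mathlib's `Tropical` takes minima, so the order of `ℝ` is reversed and `-∞`
is the top element of `WithTop ℝᵒᵈ`. -/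
abbrev MaxPlus : Type := Tropical (WithTop ℝᵒᵈ)

/-- `log : 𝕋 → ℝ ∪ {-∞}`, the underlying extended real number. -/
def log (a : MaxPlus) : WithBot ℝ := WithTop.ofDual (Tropical.untrop a)

/-- `S` is a sub-semifield of `𝕋` other than the Boolean semifield `{0, 1}`. -/
structure IsSubsemifield (S : Subsemiring MaxPlus) : Prop where
  exists_inv : ∀ a ∈ S, a ≠ 0 → ∃ b ∈ S, a * b = 1
  not_boolean : ∃ a ∈ S, a ≠ 0 ∧ a ≠ 1

/-- `Γ = log (S^×)`, a set of real numbers (a subgroup when `S` is a sub-semifield). -/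
def valueGroup (S : Subsemiring MaxPlus) : Set ℝ :=
  {γ | ∃ a ∈ S, log a = (γ : WithBot ℝ)}

/-! ### Prime congruences -/

section Congruences

variable {A : Type*} [CommSemiring A]

/-- A congruence `P` is prime if it is proper and `A / P` is totally ordered (for the canonical
order) and cancellative. -/
structure IsPrimeCong (P : RingCon A) : Prop where
  ne_top : P ≠ ⊤
  total : ∀ x y : P.Quotient, IdemLE x y ∨ IdemLE y x
  cancel : ∀ x y z : P.Quotient, x ≠ 0 → x * y = x * z → y = z

/-- `f ≤_P g`: the class of `f` is at most the class of `g` in `A / P`. -/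
def leMod (P : RingCon A) (f g : A) : Prop := IdemLE (P.mk' f) (P.mk' g)

/-- The residue semifield `κ(P)`, the total semiring of fractions of `A / P`. -/
abbrev ResidueSemifield (P : RingCon A) : Type _ :=
  Localization (nonZeroDivisors P.Quotient)

/-- The canonical map `A → κ(P)`, `f ↦ |f|_P`. -/
noncomputable def residueMap (P : RingCon A) : A →+* ResidueSemifield P :=
  (algebraMap P.Quotient (ResidueSemifield P)).comp P.mk'

/-- The canonical topology of a totally ordered semifield: every nonzero point is isolated and
the sets `{x | x < c}` with `c ≠ 0` are a basis of neighbourhoods of `0`. -/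
@[reducible] def canonicalTopology (K : Type*) [CommSemiring K] : TopologicalSpace K :=
  nhdsAdjoint 0 (⨅ c : {c : K // c ≠ 0}, Filter.principal {x | IdemLT x c.1})

/-- `Cont_K A` for a totally ordered semifield `K` and a `K`-algebra `A`: the prime congruences
`P` on `A` such that `A / P` is not finite and the map `K → A → κ(P)` is continuous. -/
structure IsCont (K : Type*) [CommSemiring K] [Algebra K A] (P : RingCon A) : Prop where
  prime : IsPrimeCong P
  infinite : Infinite P.Quotient
  continuous : @Continuous K (ResidueSemifield P)
    (canonicalTopology K) (canonicalTopology (ResidueSemifield P))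
    (fun a => residueMap P (algebraMap K A a))

end Congruences

section MonoidAlgebra

variable {M : Type*} [AddCommGroup M] {S : Subsemiring MaxPlus}

/-! ### Evaluation of polynomials and rational sets

`N_ℝ = Hom(M, ℝ)` is the type `M →+ ℝ`, with pairing `⟨x, u⟩ = x u`. -/

/-- `f(x) = max_u (log f_u + ⟨x, u⟩)`, equal to `-∞` for `f = 0`. -/
noncomputable def evalAt (f : AddMonoidAlgebra S M) (x : M →+ ℝ) : WithBot ℝ :=
  f.coeff.support.sup fun u => (log (f.coeff u : MaxPlus)).map fun γ => γ + x u

/-- The homogenization `f̃(r, x) = max_u (r log f_u + ⟨x, u⟩)`, the maximum being over the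
terms of `f`; it is `-∞` for `f = 0`. -/
noncomputable def homEvalAt (f : AddMonoidAlgebra S M) (w : ℝ≥0 × (M →+ ℝ)) : WithBot ℝ :=
  f.coeff.support.sup fun u => (log (f.coeff u : MaxPlus)).map fun γ => (w.1 : ℝ) * γ + w.2 u

/-- `R(f₀, f₁, …, f_n)`, a subset of `N_ℝ`. -/
def ratSet (f₀ : AddMonoidAlgebra S M) {n : ℕ} (f : Fin n → AddMonoidAlgebra S M) :
    Set (M →+ ℝ) :=
  {x | ∀ i, evalAt (f i) x ≤ evalAt f₀ x}

/-- `R̃(f₀, f₁, …, f_n)`, a subset of `ℝ_{≥0} × N_ℝ`. -/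
def homRatSet (f₀ : AddMonoidAlgebra S M) {n : ℕ} (f : Fin n → AddMonoidAlgebra S M) :
    Set (ℝ≥0 × (M →+ ℝ)) :=
  {w | ∀ i, homEvalAt (f i) w ≤ homEvalAt f₀ w}

end MonoidAlgebra

/-! ### Polyhedra, cones and the two lattices -/

section Polyhedra

variable (Γ : Set ℝ) {M : Type*} [AddCommGroup M]

/-- A `Γ`-rational polyhedron in `N_ℝ`: a finite intersection of half-spaces `⟨x, u⟩ ≤ γ` with
`u ∈ M`, `γ ∈ Γ`. -/
def IsRationalPolyhedron (Q : Set (M →+ ℝ)) : Prop :=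
  ∃ s : Set (ℝ × M), s.Finite ∧ (∀ p ∈ s, p.1 ∈ Γ) ∧ Q = {x | ∀ p ∈ s, x p.2 ≤ p.1}

/-- A `Γ`-rational polytope: a bounded `Γ`-rational polyhedron. As `M` spans the dual of `N_ℝ`,
a subset of `N_ℝ` is bounded iff every `u ∈ M` is bounded on it. -/
def IsRationalPolytope (Q : Set (M →+ ℝ)) : Prop :=
  IsRationalPolyhedron Γ Q ∧ ∀ u : M, ∃ B : ℝ, ∀ x ∈ Q, |x u| ≤ B

/-- A `Γ`-admissible cone in `ℝ_{≥0} × N_ℝ`: a finite intersection of half-spaces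
`r γ + ⟨x, u⟩ ≤ 0` with `u ∈ M`, `γ ∈ Γ`. -/
def IsAdmissibleCone (C : Set (ℝ≥0 × (M →+ ℝ))) : Prop :=
  ∃ s : Set (ℝ × M), s.Finite ∧ (∀ p ∈ s, p.1 ∈ Γ) ∧
    C = {w | ∀ p ∈ s, (w.1 : ℝ) * p.1 + w.2 p.2 ≤ 0}

/-- `U` is the union of a finite (possibly empty) family of sets satisfying `p`. -/
def IsFiniteUnionOf {X : Type*} (p : Set X → Prop) (U : Set X) : Prop :=
  ∃ t : Set (Set X), t.Finite ∧ (∀ Q ∈ t, p Q) ∧ U = ⋃₀ t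

theorem IsFiniteUnionOf.union {X : Type*} {p : Set X → Prop} {U V : Set X}
    (hU : IsFiniteUnionOf p U) (hV : IsFiniteUnionOf p V) : IsFiniteUnionOf p (U ∪ V) := by
  obtain ⟨s, hs, hsp, rfl⟩ := hU
  obtain ⟨t, ht, htp, rfl⟩ := hV
  exact ⟨s ∪ t, hs.union ht, fun Q hQ => hQ.elim (hsp Q) (htp Q), (Set.sUnion_union s t).symm⟩

theorem IsFiniteUnionOf.inter {X : Type*} {p : Set X → Prop}
    (hp : ∀ Q Q', p Q → p Q' → p (Q ∩ Q')) {U V : Set X}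
    (hU : IsFiniteUnionOf p U) (hV : IsFiniteUnionOf p V) : IsFiniteUnionOf p (U ∩ V) := by
  obtain ⟨s, hs, hsp, rfl⟩ := hU
  obtain ⟨t, ht, htp, rfl⟩ := hV
  refine ⟨Set.image2 (· ∩ ·) s t, hs.image2 _ ht, ?_, ?_⟩
  · rintro _ ⟨Q, hQ, Q', hQ', rfl⟩
    exact hp Q Q' (hsp Q hQ) (htp Q' hQ')
  · ext x
    simp only [Set.mem_inter_iff, Set.mem_sUnion, Set.mem_image2]
    constructor
    · rintro ⟨⟨Q, hQ, hx⟩, Q', hQ', hx'⟩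
      exact ⟨_, ⟨Q, hQ, Q', hQ', rfl⟩, hx, hx'⟩
    · rintro ⟨_, ⟨Q, hQ, Q', hQ', rfl⟩, hx, hx'⟩
      exact ⟨⟨Q, hQ, hx⟩, Q', hQ', hx'⟩

theorem IsRationalPolyhedron.inter (Q Q' : Set (M →+ ℝ)) (hQ : IsRationalPolyhedron Γ Q)
    (hQ' : IsRationalPolyhedron Γ Q') : IsRationalPolyhedron Γ (Q ∩ Q') := by
  obtain ⟨s, hs, hsΓ, rfl⟩ := hQ
  obtain ⟨t, ht, htΓ, rfl⟩ := hQ'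
  refine ⟨s ∪ t, hs.union ht, fun p hp => hp.elim (hsΓ p) (htΓ p), ?_⟩
  ext x
  exact ⟨fun h p hp => hp.elim (h.1 p) (h.2 p),
    fun h => ⟨fun p hp => h p (Or.inl hp), fun p hp => h p (Or.inr hp)⟩⟩

theorem IsAdmissibleCone.inter (C C' : Set (ℝ≥0 × (M →+ ℝ))) (hC : IsAdmissibleCone Γ C)
    (hC' : IsAdmissibleCone Γ C') : IsAdmissibleCone Γ (C ∩ C') := by
  obtain ⟨s, hs, hsΓ, rfl⟩ := hC
  obtain ⟨t, ht, htΓ, rfl⟩ := hC'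
  refine ⟨s ∪ t, hs.union ht, fun p hp => hp.elim (hsΓ p) (htΓ p), ?_⟩
  ext x
  exact ⟨fun h p hp => hp.elim (h.1 p) (h.2 p),
    fun h => ⟨fun p hp => h p (Or.inl hp), fun p hp => h p (Or.inr hp)⟩⟩

variable (M)

/-- The lattice of `Γ`-rational polyhedral sets in `N_ℝ`, that is, of finite unions of
`Γ`-rational polyhedra, ordered by inclusion, with union and intersection. -/
def polyhedralSets : Sublattice (Set (M →+ ℝ)) where
  carrier := {U | IsFiniteUnionOf (IsRationalPolyhedron Γ) U}
  supClosed' := fun _ hU _ hV => IsFiniteUnionOf.union hU hV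
  infClosed' := fun _ hU _ hV =>
    IsFiniteUnionOf.inter (IsRationalPolyhedron.inter Γ) hU hV

/-- The lattice of `Γ`-admissible fan support sets in `ℝ_{≥0} × N_ℝ`, that is, of finite unions
of `Γ`-admissible cones, ordered by inclusion, with union and intersection. -/
def fanSupportSets : Sublattice (Set (ℝ≥0 × (M →+ ℝ))) where
  carrier := {U | IsFiniteUnionOf (IsAdmissibleCone Γ) U}
  supClosed' := fun _ hU _ hV => IsFiniteUnionOf.union hU hV
  infClosed' := fun _ hU _ hV =>
    IsFiniteUnionOf.inter (IsAdmissibleCone.inter Γ) hU hV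

end Polyhedra

/-! ### The filter of a prime congruence and the preorder of a filter -/

section Filters

variable {M : Type*} [AddCommGroup M] {S : Subsemiring MaxPlus}

/-- `F̃_P`: the `Γ`-admissible fan support sets that contain `R̃(f₀, …, f_n)` for some
`f₀, …, f_n ∈ S[M]` with `f_i ≤_P f₀` for all `i`. -/
def fanFilter (P : RingCon (AddMonoidAlgebra S M)) : Set (fanSupportSets (valueGroup S) M) :=
  {U | ∃ (n : ℕ) (f₀ : AddMonoidAlgebra S M) (f : Fin n → AddMonoidAlgebra S M),
    homRatSet f₀ f ⊆ U.1 ∧ ∀ i, leMod P (f i) f₀}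

/-- `F_P`: the `Γ`-rational polyhedral sets that contain `R(f₀, …, f_n)` for some
`f₀, …, f_n ∈ S[M]` with `f_i ≤_P f₀` for all `i`. -/
def polyhedralFilter (P : RingCon (AddMonoidAlgebra S M)) :
    Set (polyhedralSets (valueGroup S) M) :=
  {U | ∃ (n : ℕ) (f₀ : AddMonoidAlgebra S M) (f : Fin n → AddMonoidAlgebra S M),
    ratSet f₀ f ⊆ U.1 ∧ ∀ i, leMod P (f i) f₀}

/-- `a χ^u ≤_F̃ b χ^v`: some member of `F̃` is contained in `R̃(b χ^v, a χ^u)`, that is,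
`r log a + ⟨x, u⟩ ≤ r log b + ⟨x, v⟩` for all its points `(r, x)`. -/
def fanTermLE (F : Order.PFilter (fanSupportSets (valueGroup S) M)) (a : S) (u : M) (b : S)
    (v : M) : Prop :=
  ∃ U ∈ F, ∀ w ∈ U.1, homEvalAt (AddMonoidAlgebra.single u a) w ≤
    homEvalAt (AddMonoidAlgebra.single v b) w

/-- `a χ^u ≤_F b χ^v`: some member of `F` is contained in `R(b χ^v, a χ^u)`, that is,
`log a + ⟨x, u⟩ ≤ log b + ⟨x, v⟩` for all its points `x`. -/
def polyhedralTermLE (F : Order.PFilter (polyhedralSets (valueGroup S) M)) (a : S) (u : M)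
    (b : S) (v : M) : Prop :=
  ∃ U ∈ F, ∀ x ∈ U.1, evalAt (AddMonoidAlgebra.single u a) x ≤
    evalAt (AddMonoidAlgebra.single v b) x

/-- `a χ^u ≤_P b χ^v`, the term preorder of a congruence. -/
def congTermLE (P : RingCon (AddMonoidAlgebra S M)) (a : S) (u : M) (b : S) (v : M) : Prop :=
  leMod P (AddMonoidAlgebra.single u a) (AddMonoidAlgebra.single v b)

end Filters

end TropFilter

open scoped NNReal

namespace TropFilter

/-! ### Term cones and separation -/

section TermCone

variable {Γ : AddSubgroup ℝ} {M : Type*} [AddCommGroup M]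

/-! Both sides of each bijection are encoded by the same data, a subset `T` of `Γ × M`. Terms are
units of `S[M]`, and modulo a prime congruence every nonzero polynomial is congruent to one of its
own terms. So a prime congruence is determined by the set `T` of terms `≤_P 1`. Such a `T` is a term
cone (`isTermCone_termCone`), and every term cone arises (`congOfTermCone`,
`termCone_congOfTermCone`).

Both lattices consist of finite unions of finite intersections of half-spaces indexed by `Γ × M`. A
prime filter is determined by the half-spaces in it, and a set `T` of half-spaces arises exactly
when it is feasible: finitely many conditions from `T`, and finitely many negated conditions from
outside `T`, have a common solution (`isFeasible_genSet`, `exists_primeFilter`).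

It remains to match feasible sets with term cones. A feasible set is a term cone because the pairing
is additive. The converse is `hasSeparation`: any finite part of the total preorder given by `T` is
realized by a real point `(r, x)`, by induction on the rank of `M`.

In the second bijection, continuity means that every term is strictly larger than some constant
(`isCont_iff`). This forces `r > 0`, so the point can be scaled to height `r = 1`
(`isFeasible_atOne`), and it corresponds to the filter containing a polytope.
`exists_equiv_primeFilters` assembles both bijections, with `φ = id` for cones and `φ = atOne` for
polyhedra. -/

/-- The elements `≤ 0` of a translation invariant total preorder on `Γ × M` that is compatible
with the order of `Γ`. -/
structure IsTermCone (T : Set (Γ × M)) : Prop where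
  add_mem : ∀ p q, p ∈ T → q ∈ T → p + q ∈ T
  total : ∀ p, p ∈ T ∨ -p ∈ T
  nonpos_mem : ∀ γ : Γ, (γ : ℝ) ≤ 0 → (γ, 0) ∈ T

/-- A point `(r, x)` as a functional `(γ, u) ↦ r γ + ⟨x, u⟩` on terms. -/
noncomputable def pairing (w : ℝ≥0 × (M →+ ℝ)) : Γ × M →+ ℝ where
  toFun g := (w.1 : ℝ) * (g.1 : ℝ) + w.2 g.2
  map_zero' := by simp
  map_add' g h := by simp; ring

theorem pairing_apply (w : ℝ≥0 × (M →+ ℝ)) (g : Γ × M) :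
    pairing w g = (w.1 : ℝ) * (g.1 : ℝ) + w.2 g.2 := rfl

namespace IsTermCone

variable {T : Set (Γ × M)}

theorem zero_mem (hT : IsTermCone T) : (0 : Γ × M) ∈ T := hT.nonpos_mem 0 le_rfl

theorem nsmul_mem (hT : IsTermCone T) {p : Γ × M} (hp : p ∈ T) (n : ℕ) : n • p ∈ T := by
  induction n with
  | zero => simpa using hT.zero_mem
  | succ n ih => rw [succ_nsmul]; exact hT.add_mem _ _ ih hp

/-- Totality makes a term cone saturated: if `-p ∈ T`, adding `k` copies of it to `(k + 1) • p`
leaves `p`. -/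
theorem of_nsmul_mem (hT : IsTermCone T) {p : Γ × M} {n : ℕ} (hn : n ≠ 0) (hp : n • p ∈ T) :
    p ∈ T := by
  obtain ⟨k, rfl⟩ := Nat.exists_eq_succ_of_ne_zero hn
  refine (hT.total p).elim id fun h => ?_
  have := hT.add_mem _ _ hp (hT.nsmul_mem h k)
  simpa [succ_nsmul, add_assoc] using this

theorem neg_mem_of_notMem (hT : IsTermCone T) {p : Γ × M} (hp : p ∉ T) : -p ∈ T :=
  (hT.total p).resolve_left hp

theorem comap {M' : Type*} [AddCommGroup M'] (hT : IsTermCone T) (φ : M' →+ M) :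
    IsTermCone {p : Γ × M' | (p.1, φ p.2) ∈ T} where
  add_mem p q hp hq := by simpa using hT.add_mem _ _ hp hq
  total p := by simpa using hT.total (p.1, φ p.2)
  nonpos_mem γ hγ := by simpa using hT.nonpos_mem γ hγ

end IsTermCone

variable (Γ M) in
/-- Every finite part of a total preorder on terms is realized by a point `(r, x)`. -/
def HasSeparation : Prop :=
  ∀ T : Set (Γ × M), IsTermCone T → ∀ A : Set (Γ × M), A.Finite →
    ∃ w : ℝ≥0 × (M →+ ℝ), ∀ g ∈ A, (g ∈ T ↔ pairing w g ≤ 0) ∧ (-g ∈ T ↔ 0 ≤ pairing w g)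

theorem HasSeparation.of_equiv {M' : Type*} [AddCommGroup M'] (e : M ≃+ M')
    (h : HasSeparation Γ M') : HasSeparation Γ M := by
  intro T hT A hA
  obtain ⟨w, hw⟩ := h _ (hT.comap e.symm.toAddMonoidHom)
    ((fun g : Γ × M => (g.1, e g.2)) '' A) (hA.image _)
  refine ⟨(w.1, w.2.comp e.toAddMonoidHom), fun ⟨γ, u⟩ hg => ?_⟩
  simpa [pairing_apply] using hw _ (Set.mem_image_of_mem _ hg)

/-- Rank zero, where only `r` is to be chosen. As `Γ` is archimedean, one positive value in `T`
forces `T` to be everything, realized by `r = 0`; otherwise `T` is the nonpositive part of `Γ`,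
realized by `r = 1`. -/
theorem hasSeparation_of_subsingleton [Subsingleton M] : HasSeparation Γ M := by
  intro T hT A _
  have key : ∀ γ : Γ, ∀ u : M, ((γ, u) : Γ × M) = (γ, 0) := fun γ u => by
    rw [Subsingleton.elim u 0]
  by_cases h : ∃ γ : Γ, 0 < (γ : ℝ) ∧ ((γ, 0) : Γ × M) ∈ T
  · obtain ⟨γ, hγ, hγT⟩ := h
    have all : ∀ g, g ∈ T := by
      rintro ⟨δ, u⟩
      rw [key]
      obtain ⟨n, hn⟩ := Archimedean.arch (δ : ℝ) hγ
      have h1 := hT.nsmul_mem hγT n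
      have h2 := hT.nonpos_mem (δ - n • γ) (by
        simpa only [AddSubgroup.coe_sub, AddSubgroup.coe_nsmul, sub_nonpos] using hn)
      simpa using hT.add_mem _ _ h1 h2
    refine ⟨(0, 0), fun g _ => ?_⟩
    simp [all, pairing_apply]
  · push Not at h
    have iff : ∀ g : Γ × M, g ∈ T ↔ (g.1 : ℝ) ≤ 0 := by
      rintro ⟨δ, u⟩
      rw [key]
      exact ⟨fun hδ => not_lt.1 fun h0 => h δ h0 hδ, hT.nonpos_mem δ⟩
    refine ⟨(1, 0), fun g _ => ?_⟩
    simp [iff, pairing_apply]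

/-- Fourier–Motzkin elimination. A term with positive exponent in the new variable bounds the new
coordinate `y` by a threshold; the induction hypothesis, applied to combinations of two terms that
eliminate the variable, orders the thresholds compatibly with `T`. -/
theorem HasSeparation.int_prod (h : HasSeparation Γ M) : HasSeparation Γ (ℤ × M) := by
  intro T hT A hA
  set T₀ : Set (Γ × M) := {p | (p.1, ((0 : ℤ), p.2)) ∈ T} with hT₀
  have hT₀c : IsTermCone T₀ := hT.comap (AddMonoidHom.inr ℤ M)
  let π : Γ × (ℤ × M) → Γ × M := fun g => (g.1, g.2.2)
  let d : Γ × (ℤ × M) → Γ × (ℤ × M) → Γ × M := fun g g' => g'.2.1 • π g - g.2.1 • π g'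
  -- Closing under negation reduces negative exponents in the new variable to positive ones.
  set A' := A ∪ Neg.neg '' A with hA'
  have hA'f : A'.Finite := hA.union (hA.image _)
  -- `d g g'` is what remains of `k' • g - k • g'`, where `k`, `k'` are the exponents of `g`, `g'`
  -- in the new variable.
  obtain ⟨w, hw⟩ := h T₀ hT₀c (π '' A' ∪ Set.image2 d A' A')
    ((hA'f.image _).union (hA'f.image2 _ hA'f))
  have hd : ∀ g g', g.2.1 > 0 → g'.2.1 > 0 →
      (d g g' ∈ T₀ ↔ g'.2.1.toNat • g - g.2.1.toNat • g' ∈ T) := by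
    intro g g' hg hg'
    have : ((d g g').1, ((0 : ℤ), (d g g').2)) = g'.2.1.toNat • g - g.2.1.toNat • g' := by
      have e1 : ∀ {X : Type _} [AddCommGroup X] (x : X), g.2.1.toNat • x = g.2.1 • x := by
        intro X _ x; rw [← natCast_zsmul, Int.toNat_of_nonneg hg.le]
      have e2 : ∀ {X : Type _} [AddCommGroup X] (x : X), g'.2.1.toNat • x = g'.2.1 • x := by
        intro X _ x; rw [← natCast_zsmul, Int.toNat_of_nonneg hg'.le]
      rw [e1, e2]
      ext
      · simp [d, π]
      · simp [mul_comm]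
      · simp [d, π]
    rw [← this]; rfl
  -- the threshold of a term with positive exponent in the new variable
  let τ : Γ × (ℤ × M) → ℝ := fun g => - pairing w (π g) / g.2.1
  have hτ : ∀ g ∈ A', ∀ g' ∈ A', g.2.1 > 0 → g'.2.1 > 0 →
      (g'.2.1.toNat • g - g.2.1.toNat • g' ∈ T ↔ τ g' ≤ τ g) := by
    intro g hg g' hg' h0 h0'
    rw [← hd g g' h0 h0', (hw (d g g') (Or.inr ⟨g, hg, g', hg', rfl⟩)).1]
    have c0 : (0 : ℝ) < g.2.1 := by exact_mod_cast h0
    have c0' : (0 : ℝ) < g'.2.1 := by exact_mod_cast h0'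
    simp only [d, τ, map_sub, map_zsmul, zsmul_eq_mul]
    rw [div_le_div_iff₀ c0' c0]
    constructor <;> intro h <;> linarith
  have hpos : ∃ y : ℝ, ∀ g ∈ A', g.2.1 > 0 → (g ∈ T ↔ y ≤ τ g) ∧ (-g ∈ T ↔ τ g ≤ y) := by
    -- A term equivalent to `0` forces `y` to be its threshold. If there is none, every threshold
    -- from outside `T` is strictly below every threshold from `T`, and any `y` strictly between
    -- works.
    by_cases hex : ∃ g ∈ A', g.2.1 > 0 ∧ g ∈ T ∧ -g ∈ T
    · obtain ⟨g₀, hg₀A, hg₀, hg₀T, hg₀T'⟩ := hex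
      refine ⟨τ g₀, fun g hg hg0 => ⟨?_, ?_⟩⟩
      · rw [← hτ g hg g₀ hg₀A hg0 hg₀]
        constructor
        · intro h
          have := hT.add_mem _ _ (hT.nsmul_mem h g₀.2.1.toNat) (hT.nsmul_mem hg₀T' g.2.1.toNat)
          simpa [sub_eq_add_neg] using this
        · intro h
          have := hT.add_mem _ _ h (hT.nsmul_mem hg₀T g.2.1.toNat)
          rw [sub_add_cancel] at this
          exact hT.of_nsmul_mem (by omega) this
      · rw [← hτ g₀ hg₀A g hg hg₀ hg0]
        constructor
        · intro h
          have := hT.add_mem _ _ (hT.nsmul_mem h g₀.2.1.toNat) (hT.nsmul_mem hg₀T g.2.1.toNat)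
          simpa [sub_eq_add_neg, add_comm] using this
        · intro h
          have := hT.add_mem _ _ h (hT.nsmul_mem hg₀T' g.2.1.toNat)
          rw [smul_neg, sub_add_eq_add_sub, add_neg_cancel, zero_sub, ← smul_neg] at this
          exact hT.of_nsmul_mem (by omega) this
    · push Not at hex
      classical
      obtain ⟨y, hy1, hy2⟩ := Order.exists_between_finsets
        ((hA'f.toFinset.filter fun g => g.2.1 > 0 ∧ g ∉ T).image τ)
        ((hA'f.toFinset.filter fun g => g.2.1 > 0 ∧ g ∈ T).image τ) (by
          simp only [Finset.mem_image, Finset.mem_filter, Set.Finite.mem_toFinset]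
          rintro _ ⟨g, ⟨hg, hg0, hgT⟩, rfl⟩ _ ⟨g', ⟨hg', hg0', hgT'⟩, rfl⟩
          refine not_le.1 fun hle => hgT ?_
          rw [← hτ g hg g' hg' hg0 hg0'] at hle
          have := hT.add_mem _ _ hle (hT.nsmul_mem hgT' g.2.1.toNat)
          rw [sub_add_cancel] at this
          exact hT.of_nsmul_mem (by omega) this)
      simp only [Finset.mem_image, Finset.mem_filter, Set.Finite.mem_toFinset] at hy1 hy2
      refine ⟨y, fun g hg hg0 => ?_⟩
      by_cases hgT : g ∈ T
      · have h1 := hy2 _ ⟨g, ⟨hg, hg0, hgT⟩, rfl⟩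
        have h2 := hex g hg hg0 hgT
        simp [hgT, h2, h1, h1.le]
      · have h1 := hy1 _ ⟨g, ⟨hg, hg0, hgT⟩, rfl⟩
        have h2 := hT.neg_mem_of_notMem hgT
        simp [hgT, h2, h1, h1.le]
  obtain ⟨y, hy⟩ := hpos
  let x : ℤ × M →+ ℝ := ((AddMonoidHom.mulRight y).comp (Int.castAddHom ℝ)).coprod w.2
  have hx : ∀ g : Γ × (ℤ × M), pairing (w.1, x) g = g.2.1 * y + pairing w (π g) := by
    intro g
    simp [pairing_apply, x, π]
    ring
  have hge : ∀ g ∈ A', g.2.1 > 0 → (g ∈ T ↔ pairing (w.1, x) g ≤ 0) ∧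
      (-g ∈ T ↔ 0 ≤ pairing (w.1, x) g) := by
    intro g hg hg0
    have c0 : (0 : ℝ) < g.2.1 := by exact_mod_cast hg0
    rw [hx, (hy g hg hg0).1, (hy g hg hg0).2, le_div_iff₀ c0, div_le_iff₀ c0]
    constructor <;> constructor <;> intro h <;> linarith
  refine ⟨(w.1, x), fun g hg => ?_⟩
  rcases lt_trichotomy g.2.1 0 with h0 | h0 | h0
  · have := hge (-g) (Or.inr ⟨g, hg, rfl⟩) (by simpa using h0)
    rw [neg_neg, map_neg, neg_nonpos, neg_nonneg] at this
    exact this.symm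
  · have := hw (π g) (Or.inl ⟨g, Or.inl hg, rfl⟩)
    rw [hx, h0, Int.cast_zero, zero_mul, zero_add, ← this.1, ← this.2]
    obtain ⟨γ, k, u⟩ := g
    simp only at h0
    subst h0
    simp [T₀, π]
  · exact hge g (Or.inl hg) h0

theorem hasSeparation_pi (n : ℕ) : HasSeparation Γ (Fin n → ℤ) := by
  induction n with
  | zero => exact hasSeparation_of_subsingleton
  | succ n ih =>
    exact ih.int_prod.of_equiv (Fin.consLinearEquiv ℤ fun _ : Fin (n + 1) => ℤ).symm.toAddEquiv

variable (Γ M) in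
theorem hasSeparation [Module.Free ℤ M] [Module.Finite ℤ M] : HasSeparation Γ M :=
  (hasSeparation_pi _).of_equiv (Module.finBasis ℤ M).equivFun.toAddEquiv

end TermCone

/-! ### Prime filters of a lattice of finite unions of finite intersections -/

section Duality

variable {X ι : Type*} (H : ι → Set X)

/-- A finite intersection of members of the family `H`. -/
def IsCell (C : Set X) : Prop := ∃ s : Set ι, s.Finite ∧ C = {x | ∀ i ∈ s, x ∈ H i}

/-- `T` is the set of members of `H` in a prime filter: no finite intersection of members
from `T` is covered by finitely many members outside `T`. -/
def IsFeasible (T : Set ι) : Prop :=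
  ∀ A B : Set ι, A.Finite → B.Finite → A ⊆ T → B ⊆ Tᶜ → ∃ x, (∀ i ∈ A, x ∈ H i) ∧ ∀ i ∈ B, x ∉ H i

variable {H}

theorem IsFiniteUnionOf.of_mem {p : Set X → Prop} {U : Set X} (h : p U) : IsFiniteUnionOf p U :=
  ⟨{U}, Set.finite_singleton U, by simpa using h, by simp⟩

theorem isCell_inter {s : Set ι} (hs : s.Finite) : IsCell H {x | ∀ i ∈ s, x ∈ H i} :=
  ⟨s, hs, rfl⟩

variable {L : Sublattice (Set X)} (hL : ∀ U, U ∈ L ↔ IsFiniteUnionOf (IsCell H) U)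

include hL

theorem cell_mem {s : Set ι} (hs : s.Finite) : {x | ∀ i ∈ s, x ∈ H i} ∈ L :=
  (hL _).2 (.of_mem (isCell_inter hs))

theorem gen_mem (i : ι) : H i ∈ L := by
  simpa using cell_mem hL (Set.finite_singleton i)

theorem empty_mem : (∅ : Set X) ∈ L := (hL _).2 ⟨∅, Set.finite_empty, by simp, by simp⟩

theorem univ_mem : (Set.univ : Set X) ∈ L := by
  simpa using cell_mem hL Set.finite_empty

omit hL in
theorem inf_mem_filter {F : Order.PFilter L} {U V : L} (hU : U ∈ F) (hV : V ∈ F) : U ⊓ V ∈ F :=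
  Order.PFilter.inf_mem hU hV

omit hL in
theorem sup_mem_filter {F : Order.PFilter L} (hF : F.IsPrime) {U V : L} (h : U ⊔ V ∈ F) :
    U ∈ F ∨ V ∈ F := by
  by_contra! hn
  obtain ⟨W, hW, hUW, hVW⟩ := hF.compl_ideal.Directed U hn.1 V hn.2
  exact hW (F.mem_of_le (sup_le hUW hVW) h)

theorem univ_mem_filter (F : Order.PFilter L) : (⟨Set.univ, univ_mem hL⟩ : L) ∈ F := by
  obtain ⟨U, hU⟩ := F.nonempty
  exact F.mem_of_le (fun _ _ => trivial) hU

theorem empty_notMem_filter {F : Order.PFilter L} (hF : F.IsPrime) :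
    (⟨∅, empty_mem hL⟩ : L) ∉ F := by
  obtain ⟨U, hU⟩ := hF.compl_ideal.Nonempty
  exact fun h => hU (F.mem_of_le (Set.empty_subset U.1) h)

omit hL in
theorem nonempty_of_mem_filter {F : Order.PFilter L} (hF : F.IsPrime) {U : L} (hU : U ∈ F) :
    U.1.Nonempty := by
  rw [Set.nonempty_iff_ne_empty]
  intro h
  obtain ⟨V, hV⟩ := hF.compl_ideal.Nonempty
  exact hV (F.mem_of_le (show U.1 ⊆ V.1 by simp [h]) hU)

/-- The members of the family `H` that lie in the filter `F`. -/
def genSet (F : Order.PFilter L) : Set ι := {i | ⟨H i, gen_mem hL i⟩ ∈ F}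

theorem cell_mem_filter {F : Order.PFilter L} {s : Set ι} (hs : s.Finite) :
    (⟨_, cell_mem hL hs⟩ : L) ∈ F ↔ s ⊆ genSet hL F := by
  constructor
  · intro h i hi
    exact F.mem_of_le (show {x | ∀ i ∈ s, x ∈ H i} ⊆ H i from fun x hx => hx i hi) h
  · induction s, hs using Set.Finite.induction_on with
    | empty =>
      intro _
      exact F.mem_of_le (fun x _ i hi => hi.elim) (univ_mem_filter hL F)
    | insert hi hs ih =>
      intro h
      rw [Set.insert_subset_iff] at h
      refine F.mem_of_le ?_ (inf_mem_filter h.1 (ih h.2))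
      rintro x ⟨hx1, hx2⟩ j (rfl | hj)
      exacts [hx1, hx2 j hj]

/-- Primeness extends from binary unions to finite covers; the empty cover is excluded because the
filter is proper. -/
theorem exists_mem_filter_of_subset_sUnion {F : Order.PFilter L} (hF : F.IsPrime)
    {t : Set (Set X)} (ht : t.Finite) (htL : ∀ C ∈ t, C ∈ L) {U : L} (hU : U ∈ F)
    (hUt : U.1 ⊆ ⋃₀ t) : ∃ C, ∃ h : C ∈ t, (⟨C, htL C h⟩ : L) ∈ F := by
  induction t, ht using Set.Finite.induction_on generalizing U with
  | empty =>
    rw [Set.sUnion_empty] at hUt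
    exact absurd (F.mem_of_le hUt hU) (empty_notMem_filter hL hF)
  | @insert C t hi hs ih =>
    have htU : ⋃₀ t ∈ L := by
      clear ih hUt hi
      induction t, hs using Set.Finite.induction_on with
      | empty => simpa using empty_mem hL
      | @insert D t hi hs ih' =>
        rw [Set.sUnion_insert]
        exact L.supClosed (htL D (by simp)) (ih' fun E hE => htL E (by
          rcases hE with rfl | hE
          · simp
          · exact Or.inr (Or.inr hE)))
    have hC := htL C (Set.mem_insert _ _)
    rw [Set.sUnion_insert] at hUt
    rcases sup_mem_filter hF (U := ⟨C, hC⟩) (V := ⟨⋃₀ t, htU⟩) (F.mem_of_le hUt hU) with h | h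
    · exact ⟨C, Set.mem_insert _ _, h⟩
    · obtain ⟨D, hD, hDF⟩ := ih (fun D hD => htL D (Or.inr hD)) h subset_rfl
      exact ⟨D, Or.inr hD, hDF⟩

/-- A member is a finite union of cells, primeness puts one of these cells in `F`, and a cell lies
in `F` as soon as its defining generators do. Hence `genSet` determines a prime filter. -/
theorem mem_filter_iff {F : Order.PFilter L} (hF : F.IsPrime) (U : L) :
    U ∈ F ↔ ∃ s : Set ι, s.Finite ∧ s ⊆ genSet hL F ∧ {x | ∀ i ∈ s, x ∈ H i} ⊆ U.1 := by
  constructor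
  · intro hU
    obtain ⟨t, ht, htc, hUt⟩ := (hL _).1 U.2
    obtain ⟨C, hC, hCF⟩ := exists_mem_filter_of_subset_sUnion hL hF ht
      (fun C hC => (hL C).2 (.of_mem (htc C hC))) hU hUt.subset
    obtain ⟨s, hs, rfl⟩ := htc C hC
    exact ⟨s, hs, (cell_mem_filter hL hs).1 hCF, hUt ▸ Set.subset_sUnion_of_mem hC⟩
  · rintro ⟨s, hs, hsF, hsU⟩
    exact F.mem_of_le hsU ((cell_mem_filter hL hs).2 hsF)

theorem isFeasible_genSet {F : Order.PFilter L} (hF : F.IsPrime) : IsFeasible H (genSet hL F) := by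
  intro A B hA hB hAF hBF
  by_contra! h
  obtain ⟨C, hC, hCF⟩ := exists_mem_filter_of_subset_sUnion hL hF (hB.image H)
    (by rintro _ ⟨i, _, rfl⟩; exact gen_mem hL i) ((cell_mem_filter hL hA).2 hAF) (by
      intro x hx
      obtain ⟨i, hi, hxi⟩ := h x hx
      exact ⟨H i, ⟨i, hi, rfl⟩, hxi⟩)
  obtain ⟨i, hi, rfl⟩ := hC
  exact hBF hi hCF

/-- The filter is generated by `T`. Feasibility gives properness with `B = ∅`, primeness with `B`
the union of two finite covers, and the absence of further generators with `B` a singleton. -/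
theorem exists_primeFilter {T : Set ι} (hT : IsFeasible H T) :
    ∃ F : Order.PFilter L, F.IsPrime ∧ genSet hL F = T := by
  have hP : Order.IsPFilter {U : L | ∃ s : Set ι, s.Finite ∧ s ⊆ T ∧ {x | ∀ i ∈ s, x ∈ H i} ⊆ U.1} :=
    Order.IsPFilter.of_def ⟨⟨_, univ_mem hL⟩, ∅, Set.finite_empty, by simp, by simp⟩ (by
      rintro U ⟨s, hs, hsT, hsU⟩ V ⟨t, ht, htT, htV⟩
      exact ⟨U ⊓ V, ⟨s ∪ t, hs.union ht, Set.union_subset hsT htT, fun x hx =>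
        ⟨hsU fun i hi => hx i (Or.inl hi), htV fun i hi => hx i (Or.inr hi)⟩⟩,
        inf_le_left, inf_le_right⟩) (by
      rintro U V hUV ⟨s, hs, hsT, hsU⟩
      exact ⟨s, hs, hsT, hsU.trans hUV⟩)
  have hmem : ∀ U, U ∈ hP.toPFilter ↔
      ∃ s : Set ι, s.Finite ∧ s ⊆ T ∧ {x | ∀ i ∈ s, x ∈ H i} ⊆ U.1 := fun U => Iff.rfl
  refine ⟨hP.toPFilter, ⟨fun U V hVU hU hV => hU (hP.toPFilter.mem_of_le hVU hV),
    ⟨⟨∅, empty_mem hL⟩, ?_⟩, ?_⟩, ?_⟩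
  · rintro ⟨s, hs, hsT, hsU⟩
    obtain ⟨x, hx, -⟩ := hT s ∅ hs Set.finite_empty hsT (by simp)
    exact hsU hx
  · -- a set outside the filter is covered by finitely many members of `H` outside `T`
    have key : ∀ U : L, U ∉ hP.toPFilter →
        ∃ B : Set ι, B.Finite ∧ B ⊆ Tᶜ ∧ ∀ x ∈ U.1, ∃ i ∈ B, x ∈ H i := by
      intro U hU
      obtain ⟨t, ht, htc, hUt⟩ := (hL _).1 U.2
      have : ∀ C ∈ t, ∃ i, i ∉ T ∧ C ⊆ H i := by
        intro C hC
        obtain ⟨s, hs, rfl⟩ := htc C hC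
        by_contra! hn
        refine hU ((hmem U).2 ⟨s, hs, fun i hi => ?_, hUt ▸ Set.subset_sUnion_of_mem hC⟩)
        by_contra hiT
        exact hn i hiT fun x hx => hx i hi
      choose f hf using this
      have := ht.to_subtype
      refine ⟨Set.range fun C : t => f C.1 C.2, Set.finite_range _, ?_, fun x hx => ?_⟩
      · rintro _ ⟨C, rfl⟩
        exact (hf C.1 C.2).1
      · rw [hUt] at hx
        obtain ⟨C, hC, hxC⟩ := hx
        exact ⟨f C hC, ⟨⟨C, hC⟩, rfl⟩, (hf C hC).2 hxC⟩
    intro U hU V hV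
    refine ⟨U ⊔ V, ?_, le_sup_left, le_sup_right⟩
    rintro ⟨s, hs, hsT, hsU⟩
    obtain ⟨B, hB, hBT, hBU⟩ := key U hU
    obtain ⟨B', hB', hBT', hBU'⟩ := key V hV
    obtain ⟨x, hx, hxB⟩ := hT s (B ∪ B') hs (hB.union hB') hsT (Set.union_subset hBT hBT')
    rcases hsU hx with h | h
    · obtain ⟨i, hi, hxi⟩ := hBU x h
      exact hxB i (Or.inl hi) hxi
    · obtain ⟨i, hi, hxi⟩ := hBU' x h
      exact hxB i (Or.inr hi) hxi
  · ext i
    constructor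
    · rintro ⟨s, hs, hsT, hsU⟩
      by_contra hi
      obtain ⟨x, hx, hxi⟩ := hT s {i} hs (Set.finite_singleton i) hsT (by simpa using hi)
      exact hxi i rfl (hsU hx)
    · intro hi
      exact ⟨{i}, Set.finite_singleton i, by simpa using hi, by simp⟩

theorem primeFilter_ext {F F' : Order.PFilter L} (hF : F.IsPrime) (hF' : F'.IsPrime)
    (h : genSet hL F = genSet hL F') : F = F' := by
  refine SetLike.ext fun U => ?_
  rw [mem_filter_iff hL hF, mem_filter_iff hL hF', h]

end Duality

/-! ### The logarithm on a sub-semifield of the tropical semifield -/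

section Log

theorem log_eq_bot {a : MaxPlus} : log a = ⊥ ↔ a = 0 := by
  constructor
  · intro h
    exact Tropical.untrop_injective h
  · rintro rfl
    rfl

theorem log_injective : Function.Injective log := fun _ _ h =>
  Tropical.untrop_injective (WithTop.ofDual.injective h)

theorem log_mul (a b : MaxPlus) : log (a * b) = log a + log b := by
  unfold log
  rw [Tropical.untrop_mul]
  cases Tropical.untrop a <;> cases Tropical.untrop b <;> rfl

/-- Addition in `Tropical` is a minimum, which becomes a maximum because the order of `ℝ` is
reversed. -/
theorem log_add (a b : MaxPlus) : log (a + b) = max (log a) (log b) := by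
  unfold log
  rw [Tropical.untrop_add]
  rcases le_total (Tropical.untrop a) (Tropical.untrop b) with h | h
  · rw [min_eq_left h, max_eq_left (WithTop.ofDual_le_ofDual_iff.2 h)]
  · rw [min_eq_right h, max_eq_right (WithTop.ofDual_le_ofDual_iff.2 h)]

theorem log_one : log 1 = 0 := rfl

/-- The real number `log a`, with value `0` at `a = 0`. -/
noncomputable def realLog (a : MaxPlus) : ℝ := (log a).unbotD 0

theorem coe_realLog {a : MaxPlus} (ha : a ≠ 0) : ((realLog a : ℝ) : WithBot ℝ) = log a := by
  obtain ⟨r, hr⟩ := WithBot.ne_bot_iff_exists.1 (log_eq_bot.not.2 ha)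
  simp [realLog, ← hr]

theorem realLog_mul {a b : MaxPlus} (ha : a ≠ 0) (hb : b ≠ 0) :
    realLog (a * b) = realLog a + realLog b := by
  apply WithBot.coe_injective
  have hab : a * b ≠ 0 := by
    rw [Ne, ← log_eq_bot] at ha hb ⊢
    rw [log_mul, WithBot.add_eq_bot]
    tauto
  rw [WithBot.coe_add, coe_realLog hab, coe_realLog ha, coe_realLog hb, log_mul]

theorem add_eq_right_iff {a b : MaxPlus} (ha : a ≠ 0) (hb : b ≠ 0) :
    a + b = b ↔ realLog a ≤ realLog b := by
  rw [← log_injective.eq_iff, log_add, max_eq_right_iff, ← coe_realLog ha, ← coe_realLog hb,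
    WithBot.coe_le_coe]

variable {S : Subsemiring MaxPlus}

/-- `Γ = log (S^×)` as a subgroup of `ℝ`. -/
def valueSubgroup (hS : IsSubsemifield S) : AddSubgroup ℝ where
  carrier := valueGroup S
  zero_mem' := ⟨1, S.one_mem, log_one⟩
  add_mem' := by
    rintro γ δ ⟨a, ha, haγ⟩ ⟨b, hb, hbδ⟩
    exact ⟨a * b, S.mul_mem ha hb, by rw [log_mul, haγ, hbδ, WithBot.coe_add]⟩
  neg_mem' := by
    rintro γ ⟨a, ha, haγ⟩
    have ha0 : a ≠ 0 := fun h => by rw [← log_eq_bot, haγ] at h; exact WithBot.coe_ne_bot h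
    obtain ⟨b, hb, hab⟩ := hS.exists_inv a ha ha0
    have h := congrArg log hab
    have hb0 : b ≠ 0 := fun h0 => by
      rw [h0, mul_zero] at hab
      exact zero_ne_one hab
    rw [log_mul, haγ, ← coe_realLog hb0, ← WithBot.coe_add, log_one, WithBot.coe_eq_zero] at h
    refine ⟨b, hb, ?_⟩
    rw [← coe_realLog hb0, eq_neg_of_add_eq_zero_right h]

variable (hS : IsSubsemifield S)

theorem exists_pos_value : ∃ γ : valueSubgroup hS, 0 < (γ : ℝ) := by
  obtain ⟨a, ha, ha0, ha1⟩ := hS.not_boolean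
  have hγ : realLog a ∈ valueSubgroup hS := ⟨a, ha, (coe_realLog ha0).symm⟩
  have hne : realLog a ≠ 0 := fun h => ha1 (log_injective (by
    rw [← coe_realLog ha0, h, log_one, WithBot.coe_zero]))
  rcases hne.lt_or_gt with h | h
  · exact ⟨-⟨_, hγ⟩, by simpa using h⟩
  · exact ⟨⟨_, hγ⟩, h⟩

/-- This is where `S` not being Boolean enters: `Γ` is a nonzero subgroup of `ℝ`, hence unbounded
below. -/
theorem exists_value_lt (c : ℝ) : ∃ γ : valueSubgroup hS, (γ : ℝ) < c := by
  obtain ⟨γ, hγ⟩ := exists_pos_value hS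
  obtain ⟨n, hn⟩ := exists_nat_gt (-c / γ)
  refine ⟨-(n • γ), ?_⟩
  rw [div_lt_iff₀ hγ] at hn
  simp only [AddSubgroup.coe_neg, AddSubgroup.coe_nsmul, nsmul_eq_mul]
  linarith

/-- `log a` as an element of `Γ`, with value `0` at `a = 0`. -/
noncomputable def valueLog (a : S) : valueSubgroup hS :=
  ⟨realLog a.1, by
    by_cases ha : a.1 = 0
    · rw [ha]
      exact (valueSubgroup hS).zero_mem
    · exact ⟨a.1, a.2, (coe_realLog ha).symm⟩⟩

/-- The element of `S` with logarithm `γ`. -/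
def valueExp (γ : valueSubgroup hS) : S :=
  ⟨Tropical.trop ((OrderDual.toDual (γ : ℝ) : ℝᵒᵈ) : WithTop ℝᵒᵈ), by
    obtain ⟨a, ha, haγ⟩ := γ.2
    rwa [show Tropical.trop ((OrderDual.toDual (γ : ℝ) : ℝᵒᵈ) : WithTop ℝᵒᵈ) = a from
      log_injective (by rw [haγ]; rfl)]⟩

theorem log_valueExp (γ : valueSubgroup hS) : log (valueExp hS γ).1 = ((γ : ℝ) : WithBot ℝ) := rfl

theorem valueExp_ne_zero (γ : valueSubgroup hS) : valueExp hS γ ≠ 0 := by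
  intro h
  have := congrArg (fun a : S => log a.1) h
  exact WithBot.coe_ne_bot this

theorem valueLog_valueExp (γ : valueSubgroup hS) : valueLog hS (valueExp hS γ) = γ := rfl

theorem coe_ne_zero {a : S} (ha : a ≠ 0) : a.1 ≠ 0 := fun h => ha (Subtype.ext h)

theorem valueExp_valueLog {a : S} (ha : a ≠ 0) : valueExp hS (valueLog hS a) = a :=
  Subtype.ext (log_injective (by
    rw [log_valueExp]
    exact coe_realLog (coe_ne_zero ha)))

theorem valueExp_add (γ δ : valueSubgroup hS) :
    valueExp hS (γ + δ) = valueExp hS γ * valueExp hS δ :=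
  Subtype.ext (log_injective (by
    rw [Subsemiring.coe_mul, log_mul, log_valueExp, log_valueExp, log_valueExp]
    rfl))

theorem valueExp_zero : valueExp hS 0 = 1 :=
  Subtype.ext (log_injective (by rw [log_valueExp]; rfl))

theorem valueLog_mul {a b : S} (ha : a ≠ 0) (hb : b ≠ 0) :
    valueLog hS (a * b) = valueLog hS a + valueLog hS b :=
  Subtype.ext (realLog_mul (coe_ne_zero ha) (coe_ne_zero hb))

theorem subsemiring_add_eq_right_iff {a b : S} (ha : a ≠ 0) (hb : b ≠ 0) :
    a + b = b ↔ valueLog hS a ≤ valueLog hS b := by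
  rw [← Subtype.coe_inj, Subsemiring.coe_add, add_eq_right_iff (coe_ne_zero ha) (coe_ne_zero hb)]
  rfl

theorem subsemiring_add_self (a : S) : a + a = a := Subtype.ext (Tropical.add_self a.1)

theorem subsemiring_add_eq_zero {a b : S} : a + b = 0 ↔ a = 0 ∧ b = 0 := by
  constructor
  · intro h
    have h' := congrArg (fun c : S => log c.1) h
    simp only [Subsemiring.coe_add, log_add] at h'
    rw [Subsemiring.coe_zero, log_eq_bot.2 rfl, max_eq_bot, log_eq_bot, log_eq_bot] at h'
    exact ⟨Subtype.ext h'.1, Subtype.ext h'.2⟩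
  · rintro ⟨rfl, rfl⟩
    exact add_zero 0

include hS in
theorem subsemiring_mul_ne_zero {a b : S} (ha : a ≠ 0) (hb : b ≠ 0) : a * b ≠ 0 := by
  rw [← valueExp_valueLog hS ha, ← valueExp_valueLog hS hb, ← valueExp_add]
  exact valueExp_ne_zero hS _

end Log

/-! ### The order of an idempotent semiring -/

section IdemLE

variable {R : Type*} [CommSemiring R] {x y z : R}

theorem IdemLE.trans (h : IdemLE x y) (h' : IdemLE y z) : IdemLE x z := by
  unfold IdemLE at *
  rw [← h', ← add_assoc, h]

theorem IdemLE.antisymm (h : IdemLE x y) (h' : IdemLE y x) : x = y := by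
  unfold IdemLE at *
  rw [← h', add_comm, h]

theorem IdemLE.mul_right (h : IdemLE x y) (z : R) : IdemLE (x * z) (y * z) := by
  unfold IdemLE at *
  rw [← add_mul, h]

theorem idemLE_zero_iff : IdemLE x 0 ↔ x = 0 := by
  unfold IdemLE
  rw [add_zero]

/-- When the canonical order is total, a finite sum is the largest of its summands. This is what
makes a polynomial congruent to one of its terms. -/
theorem exists_sum_eq_of_total (ht : ∀ x y : R, IdemLE x y ∨ IdemLE y x) {κ : Type*}
    {s : Finset κ} (hs : s.Nonempty) (f : κ → R) : ∃ i ∈ s, ∑ j ∈ s, f j = f i := by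
  induction hs using Finset.Nonempty.cons_induction with
  | singleton a => exact ⟨a, by simp⟩
  | cons a s ha hs ih =>
    obtain ⟨i, hi, h⟩ := ih
    rw [Finset.sum_cons, h]
    rcases ht (f a) (f i) with h' | h'
    · exact ⟨i, Finset.mem_cons_of_mem hi, h'⟩
    · exact ⟨a, Finset.mem_cons_self a s, by rw [add_comm]; exact h'⟩

variable {P : RingCon R}

theorem leMod_trans (h : leMod P x y) (h' : leMod P y z) : leMod P x z :=
  IdemLE.trans (R := P.Quotient) h h'

theorem mk_eq_of_leMod (h : leMod P x y) (h' : leMod P y x) : P.mk' x = P.mk' y :=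
  IdemLE.antisymm (R := P.Quotient) h h'

theorem leMod_mul_right (h : leMod P x y) (z : R) : leMod P (x * z) (y * z) := by
  unfold leMod
  rw [map_mul, map_mul]
  exact IdemLE.mul_right (R := P.Quotient) h _

theorem leMod_zero_iff : leMod P x 0 ↔ P.mk' x = 0 := by
  unfold leMod
  rw [map_zero]
  exact idemLE_zero_iff (R := P.Quotient)

end IdemLE

/-! ### Prime congruences and term cones -/

section Congruence

open AddMonoidAlgebra

variable {M : Type*} [AddCommGroup M] {S : Subsemiring MaxPlus} (hS : IsSubsemifield S)

/-- The monomial with logarithmic coefficient and exponent `g`. -/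
noncomputable def term (g : valueSubgroup hS × M) : AddMonoidAlgebra S M :=
  single g.2 (valueExp hS g.1)

/-- The logarithmic coefficient and exponent of the monomial `a χ^u`. -/
noncomputable def logTerm (a : S) (u : M) : valueSubgroup hS × M := (valueLog hS a, u)

omit [AddCommGroup M] in
theorem single_eq_term {a : S} (ha : a ≠ 0) (u : M) : single u a = term hS (logTerm hS a u) := by
  simp [term, logTerm, valueExp_valueLog hS ha]

theorem term_zero : term hS (0 : valueSubgroup hS × M) = 1 := by
  simp [term, valueExp_zero, one_def]

theorem term_add (g h : valueSubgroup hS × M) : term hS (g + h) = term hS g * term hS h := by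
  simp [term, valueExp_add, single_mul_single]

theorem term_mul_neg (g : valueSubgroup hS × M) : term hS g * term hS (-g) = 1 := by
  rw [← term_add, add_neg_cancel, term_zero]

theorem algebra_add_self (f : AddMonoidAlgebra S M) : f + f = f := by
  ext u
  simp [subsemiring_add_self]

omit [AddCommGroup M] in
theorem sum_support_single (f : AddMonoidAlgebra S M) :
    ∑ u ∈ f.coeff.support, single u (f.coeff u) = f := sum_coeff_single f

/-! ### The term cone of a prime congruence. -/

section Prime

variable (P : RingCon (AddMonoidAlgebra S M))

theorem mk_eq_mk_iff {f g : AddMonoidAlgebra S M} : P.mk' f = P.mk' g ↔ P f g := P.eq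

theorem quotient_add_self (x : P.Quotient) : x + x = x := by
  obtain ⟨f, rfl⟩ := P.mk'_surjective x
  rw [← map_add, algebra_add_self]

/-- The terms `≤ 1` modulo `P`. -/
def termCone : Set (valueSubgroup hS × M) := {g | leMod P (term hS g) 1}

/-- Terms are units, so comparing two of them amounts to comparing their quotient with `1`. -/
theorem leMod_term_iff (g h : valueSubgroup hS × M) :
    leMod P (term hS g) (term hS h) ↔ g - h ∈ termCone hS P := by
  constructor
  · intro H
    have := leMod_mul_right H (term hS (-h))
    rwa [← term_add, ← sub_eq_add_neg, term_mul_neg] at this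
  · intro H
    have := leMod_mul_right (P := P) H (term hS h)
    rwa [← term_add, one_mul, sub_add_cancel] at this

theorem leMod_single_self (f : AddMonoidAlgebra S M) (u : M) :
    leMod P (single u (f.coeff u)) f := by
  unfold leMod IdemLE
  conv_lhs => rw [← single_add_erase u f]
  conv_rhs => rw [← single_add_erase u f]
  rw [coeff_add, coeff_single, Finsupp.add_apply, Finsupp.single_eq_same, coeff_erase,
    Finsupp.erase_same, add_zero, map_add, ← add_assoc, quotient_add_self]

variable {P}

theorem isTermCone_termCone (hP : IsPrimeCong P) : IsTermCone (termCone (M := M) hS P) where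
  add_mem p q hp hq := by
    have h1 := leMod_mul_right (P := P) hp (term hS q)
    rw [← term_add, one_mul] at h1
    exact leMod_trans h1 hq
  total p := by
    refine (hP.total (P.mk' (term hS p)) (P.mk' 1)).imp id fun h => ?_
    have h1 := leMod_mul_right (P := P) h (term hS (-p))
    rwa [term_mul_neg, one_mul] at h1
  nonpos_mem γ hγ := by
    have : term hS ((γ, 0) : valueSubgroup hS × M) + 1 = 1 := by
      rw [one_def, term, ← single_add]
      congr 1
      rw [subsemiring_add_eq_right_iff hS (valueExp_ne_zero hS _) one_ne_zero, ← valueExp_zero hS]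
      exact hγ
    change P.mk' _ + P.mk' _ = P.mk' _
    rw [← map_add, this]

theorem exists_leading_term (hP : IsPrimeCong P) {f : AddMonoidAlgebra S M} (hf : f ≠ 0) :
    ∃ u ∈ f.coeff.support, P.mk' f = P.mk' (single u (f.coeff u)) := by
  obtain ⟨u, hu, h⟩ := exists_sum_eq_of_total hP.total
    (s := f.coeff.support) (by simpa [Finsupp.support_nonempty_iff] using hf)
    fun u => P.mk' (single u (f.coeff u))
  refine ⟨u, hu, ?_⟩
  rw [← h, ← map_sum, sum_support_single]

theorem mk_term_ne_zero (hP : IsPrimeCong P) (g : valueSubgroup hS × M) :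
    P.mk' (term hS g) ≠ 0 := by
  intro h
  apply hP.ne_top
  rw [← RingCon.subsingleton_quotient]
  apply subsingleton_of_zero_eq_one
  rw [← map_one P.mk', ← term_mul_neg hS g, map_mul, h, zero_mul]

/-- In particular nonzero classes are units, so the quotient is already a semifield. -/
theorem exists_eq_mk_term (hP : IsPrimeCong P) {x : P.Quotient} (hx : x ≠ 0) :
    ∃ g : valueSubgroup hS × M, x = P.mk' (term hS g) := by
  obtain ⟨f, rfl⟩ := P.mk'_surjective x
  have hf : f ≠ 0 := fun h => hx (by rw [h, map_zero])
  obtain ⟨u, hu, h⟩ := exists_leading_term hP hf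
  exact ⟨_, by rw [h, single_eq_term hS (Finsupp.mem_support_iff.1 hu)]⟩

/-- The dominating term of `g` can be taken to be its leading term, and `f` is congruent to its own
leading term. So the whole preorder `≤_P`, and hence `P`, depends only on the term cone. -/
theorem leMod_iff (hP : IsPrimeCong P) (f g : AddMonoidAlgebra S M) :
    leMod P f g ↔ ∀ u ∈ f.coeff.support, ∃ v ∈ g.coeff.support,
      logTerm hS (f.coeff u) u - logTerm hS (g.coeff v) v ∈ termCone hS P := by
  constructor
  · intro h u hu
    have hu0 := Finsupp.mem_support_iff.1 hu
    have h1 : leMod P (single u (f.coeff u)) g := leMod_trans (leMod_single_self P f u) h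
    rw [single_eq_term hS hu0] at h1
    by_cases hg : g = 0
    · rw [hg, leMod_zero_iff] at h1
      exact absurd h1 (mk_term_ne_zero hS hP _)
    · obtain ⟨v, hv, hgv⟩ := exists_leading_term hP hg
      refine ⟨v, hv, ?_⟩
      rw [← leMod_term_iff, ← single_eq_term hS (Finsupp.mem_support_iff.1 hv), leMod, ← hgv]
      exact h1
  · intro h
    by_cases hf : f = 0
    · rw [hf, leMod, map_zero, IdemLE, zero_add]
    · obtain ⟨u, hu, hfu⟩ := exists_leading_term hP hf
      obtain ⟨v, hv, huv⟩ := h u hu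
      rw [← leMod_term_iff, ← single_eq_term hS (Finsupp.mem_support_iff.1 hv),
        ← single_eq_term hS (Finsupp.mem_support_iff.1 hu)] at huv
      rw [leMod, hfu]
      exact leMod_trans (P := P) huv (leMod_single_self P g v)

theorem primeCong_ext {P' : RingCon (AddMonoidAlgebra S M)} (hP : IsPrimeCong P)
    (hP' : IsPrimeCong P') (h : termCone hS P = termCone hS P') : P = P' := by
  have key : ∀ f g, leMod P f g ↔ leMod P' f g := fun f g => by
    rw [leMod_iff hS hP, leMod_iff hS hP', h]
  have key' : ∀ Q : RingCon (AddMonoidAlgebra S M), ∀ f g, Q f g ↔ leMod Q f g ∧ leMod Q g f := by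
    intro Q f g
    rw [← mk_eq_mk_iff]
    refine ⟨fun h => ?_, fun h => mk_eq_of_leMod h.1 h.2⟩
    rw [leMod, leMod, h]
    exact ⟨quotient_add_self Q _, quotient_add_self Q _⟩
  ext f g
  rw [key', key', key, key]

end Prime

/-! ### The prime congruence of a term cone. -/

section OfTermCone

variable (T : Set (valueSubgroup hS × M))

/-- All terms of `f` are `≤ t`. -/
def IsTermBound (f : AddMonoidAlgebra S M) (t : valueSubgroup hS × M) : Prop :=
  ∀ u, f.coeff u ≠ 0 → logTerm hS (f.coeff u) u - t ∈ T

variable {T}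

theorem isTermBound_zero (t : valueSubgroup hS × M) : IsTermBound hS T 0 t := by
  intro u hu
  simp at hu

theorem isTermBound_term (g t : valueSubgroup hS × M) :
    IsTermBound hS T (term hS g) t ↔ g - t ∈ T := by
  constructor
  · intro h
    have h1 := h g.2
    simp only [term, coeff_single, Finsupp.single_eq_same] at h1
    exact h1 (valueExp_ne_zero hS _)
  · intro h u hu
    have : u = g.2 := by
      by_contra hne
      simp [term, Finsupp.single_eq_of_ne hne] at hu
    subst this
    simp only [term, coeff_single, Finsupp.single_eq_same]
    exact h

theorem algebra_add_eq_zero {f g : AddMonoidAlgebra S M} : f + g = 0 ↔ f = 0 ∧ g = 0 := by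
  constructor
  · intro h
    have h1 : ∀ u, f.coeff u = 0 ∧ g.coeff u = 0 := fun u => by
      rw [← subsemiring_add_eq_zero, ← Finsupp.add_apply, ← coeff_add, h, coeff_zero,
        Finsupp.zero_apply]
    exact ⟨AddMonoidAlgebra.ext (Finsupp.ext fun u => (h1 u).1),
      AddMonoidAlgebra.ext (Finsupp.ext fun u => (h1 u).2)⟩
  · rintro ⟨rfl, rfl⟩
    exact add_zero 0

theorem sum_eq_zero_iff_algebra {κ : Type*} (s : Finset κ) (f : κ → AddMonoidAlgebra S M) :
    ∑ i ∈ s, f i = 0 ↔ ∀ i ∈ s, f i = 0 := by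
  classical
  induction s using Finset.induction_on with
  | empty => simp
  | insert a s ha ih => rw [Finset.sum_insert ha, algebra_add_eq_zero, ih, Finset.forall_mem_insert]

theorem mul_term_eq_zero {f : AddMonoidAlgebra S M} (g : valueSubgroup hS × M) :
    f * term hS g = 0 ↔ f = 0 := by
  constructor
  · intro h
    rw [← mul_one f, ← term_mul_neg hS g, ← mul_assoc, h, zero_mul]
  · rintro rfl
    exact zero_mul _

theorem mul_eq_sum_terms (f g : AddMonoidAlgebra S M) :
    f * g = ∑ v ∈ g.coeff.support, f * term hS (logTerm hS (g.coeff v) v) := by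
  conv_lhs => rw [← sum_support_single g]
  rw [Finset.mul_sum]
  exact Finset.sum_congr rfl fun v hv => by rw [single_eq_term hS (Finsupp.mem_support_iff.1 hv)]

include hS in
theorem algebra_mul_eq_zero {f g : AddMonoidAlgebra S M} : f * g = 0 ↔ f = 0 ∨ g = 0 := by
  rw [mul_eq_sum_terms hS, sum_eq_zero_iff_algebra]
  simp only [mul_term_eq_zero]
  by_cases hg : g = 0
  · simp [hg]
  · have : g.coeff.support.Nonempty := by simpa [Finsupp.support_nonempty_iff] using hg
    obtain ⟨v, hv⟩ := this
    exact ⟨fun h => Or.inl (h v hv), fun h _ _ => h.resolve_right hg⟩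

variable (hT : IsTermCone T)

include hT

/-- A coefficient of the sum is the larger of two coefficients, and bounding the larger term bounds
the smaller one with the same exponent. -/
theorem isTermBound_add (f g : AddMonoidAlgebra S M) (t : valueSubgroup hS × M) :
    IsTermBound hS T (f + g) t ↔ IsTermBound hS T f t ∧ IsTermBound hS T g t := by
  have aux : ∀ a b : S, ∀ u : M, a ≠ 0 → b ≠ 0 → valueLog hS a ≤ valueLog hS b →
      logTerm hS b u - t ∈ T → logTerm hS a u - t ∈ T := by
    intro a b u ha hb hab h
    have h1 := hT.nonpos_mem (valueLog hS a - valueLog hS b) (by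
      rw [AddSubgroup.coe_sub, sub_nonpos]; exact hab)
    have := hT.add_mem _ _ h1 h
    convert this using 1
    ext <;> simp [logTerm]
  have key : ∀ (a b : S) (u : M), (a + b ≠ 0 → logTerm hS (a + b) u - t ∈ T) ↔
      (a ≠ 0 → logTerm hS a u - t ∈ T) ∧ (b ≠ 0 → logTerm hS b u - t ∈ T) := by
    intro a b u
    by_cases ha : a = 0
    · simp [ha]
    by_cases hb : b = 0
    · simp [hb]
    have hab : a + b ≠ 0 := fun h => ha (subsemiring_add_eq_zero.1 h).1
    simp only [ne_eq, ha, hb, hab, not_false_eq_true, forall_const]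
    rcases le_total (valueLog hS a) (valueLog hS b) with h | h
    · rw [(subsemiring_add_eq_right_iff hS ha hb).2 h]
      exact ⟨fun h' => ⟨aux a b u ha hb h h', h'⟩, fun h' => h'.2⟩
    · rw [add_comm a b, (subsemiring_add_eq_right_iff hS hb ha).2 h]
      exact ⟨fun h' => ⟨h', aux b a u hb ha h h'⟩, fun h' => h'.1⟩
  unfold IsTermBound
  rw [← forall_and]
  exact forall_congr' fun u => key _ _ u

theorem isTermBound_sum {κ : Type*} (s : Finset κ) (f : κ → AddMonoidAlgebra S M)
    (t : valueSubgroup hS × M) :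
    IsTermBound hS T (∑ i ∈ s, f i) t ↔ ∀ i ∈ s, IsTermBound hS T (f i) t := by
  classical
  induction s using Finset.induction_on with
  | empty => simp [isTermBound_zero]
  | insert a s ha ih => rw [Finset.sum_insert ha, isTermBound_add hS hT, ih,
      Finset.forall_mem_insert]

omit hT in
theorem isTermBound_mul_term (f : AddMonoidAlgebra S M) (g t : valueSubgroup hS × M) :
    IsTermBound hS T (f * term hS g) t ↔ IsTermBound hS T f (t - g) := by
  have hcoeff : ∀ u, (f * term hS g).coeff u = f.coeff (u + -g.2) * valueExp hS g.1 :=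
    fun u => coeff_mul_single_apply f _ _ _
  have hlog : ∀ u, f.coeff u ≠ 0 →
      logTerm hS (f.coeff u * valueExp hS g.1) (u + g.2) = logTerm hS (f.coeff u) u + g := by
    intro u hu
    rw [logTerm, valueLog_mul hS hu (valueExp_ne_zero hS _), valueLog_valueExp]
    rfl
  constructor
  · intro h u hu
    have h1 := h (u + g.2)
    rw [hcoeff, add_neg_cancel_right, hlog u hu] at h1
    rw [sub_sub_eq_add_sub]
    exact h1 (subsemiring_mul_ne_zero hS hu (valueExp_ne_zero hS _))
  · intro h u hu
    rw [hcoeff] at hu ⊢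
    have h1 := h (u + -g.2) (left_ne_zero_of_mul hu)
    rw [sub_sub_eq_add_sub, ← hlog _ (left_ne_zero_of_mul hu), neg_add_cancel_right] at h1
    exact h1

/-- The bounds of `f * g` depend on `f` only through the bounds of `f`, which makes `congOfTermCone`
multiplicative. -/
theorem isTermBound_mul (f g : AddMonoidAlgebra S M) (t : valueSubgroup hS × M) :
    IsTermBound hS T (f * g) t ↔
      ∀ v ∈ g.coeff.support, IsTermBound hS T f (t - logTerm hS (g.coeff v) v) := by
  rw [mul_eq_sum_terms hS, isTermBound_sum hS hT]
  simp only [isTermBound_mul_term]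

/-- The congruence of a term cone: two polynomials are congruent if their terms have the same
upper bounds. -/
def congOfTermCone : RingCon (AddMonoidAlgebra S M) :=
  have mul_aux : ∀ f f' g : AddMonoidAlgebra S M,
      (∀ t, IsTermBound hS T f t ↔ IsTermBound hS T f' t) →
      ∀ t, IsTermBound hS T (f * g) t ↔ IsTermBound hS T (f' * g) t := by
    intro f f' g h t
    rw [isTermBound_mul hS hT, isTermBound_mul hS hT]
    simp only [h]
  -- The clause on zero matters when `T` is everything: every `t` then bounds every polynomial, and
  -- bounds alone would identify `0` with `1`.
  { r := fun f g => (∀ t, IsTermBound hS T f t ↔ IsTermBound hS T g t) ∧ (f = 0 ↔ g = 0)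
    iseqv :=
      ⟨fun _ => ⟨fun _ => Iff.rfl, Iff.rfl⟩, fun h => ⟨fun t => (h.1 t).symm, h.2.symm⟩,
        fun h h' => ⟨fun t => (h.1 t).trans (h'.1 t), h.2.trans h'.2⟩⟩
    add' := by
      intro f f' g g' h h'
      refine ⟨fun t => ?_, ?_⟩
      · rw [isTermBound_add hS hT, isTermBound_add hS hT, h.1, h'.1]
      · rw [algebra_add_eq_zero, algebra_add_eq_zero, h.2, h'.2]
    mul' := by
      intro f f' g g' h h'
      refine ⟨fun t => ?_, ?_⟩
      · rw [mul_aux f f' g h.1, mul_comm f' g, mul_aux g g' f' h'.1, mul_comm g' f']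
      · rw [algebra_mul_eq_zero hS, algebra_mul_eq_zero hS, h.2, h'.2] }

theorem congOfTermCone_rel (f g : AddMonoidAlgebra S M) : congOfTermCone hS hT f g ↔
    (∀ t, IsTermBound hS T f t ↔ IsTermBound hS T g t) ∧ (f = 0 ↔ g = 0) := Iff.rfl

theorem leMod_congOfTermCone (f g : AddMonoidAlgebra S M) : leMod (congOfTermCone hS hT) f g ↔
    (∀ t, IsTermBound hS T g t → IsTermBound hS T f t) ∧ (g = 0 → f = 0) := by
  unfold leMod IdemLE
  rw [← map_add, mk_eq_mk_iff, congOfTermCone_rel, algebra_add_eq_zero]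
  simp only [isTermBound_add hS hT, and_iff_right_iff_imp]

theorem termCone_congOfTermCone : termCone hS (congOfTermCone hS hT) = T := by
  ext g
  change leMod (congOfTermCone hS hT) (term hS g) 1 ↔ _
  rw [leMod_congOfTermCone, ← term_zero hS]
  simp only [isTermBound_term]
  constructor
  · intro h
    simpa using h.1 0 (by simpa using hT.zero_mem)
  · intro h
    refine ⟨fun t ht => ?_, fun h0 => ?_⟩
    · have := hT.add_mem _ _ h ht
      rwa [zero_sub, ← sub_eq_add_neg] at this
    · simp only [term, single_eq_zero] at h0
      exact absurd h0 (valueExp_ne_zero hS _)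

/-- Totality of `T` makes the sets of upper bounds nested. Once the order is total, every nonzero
class is that of a term, hence a unit, and cancellation follows. -/
theorem isPrimeCong_congOfTermCone : IsPrimeCong (congOfTermCone hS hT) := by
  have htotal : ∀ x y : (congOfTermCone hS hT).Quotient, IdemLE x y ∨ IdemLE y x := by
    intro x y
    obtain ⟨f, rfl⟩ := (congOfTermCone hS hT).mk'_surjective x
    obtain ⟨g, rfl⟩ := (congOfTermCone hS hT).mk'_surjective y
    change leMod _ f g ∨ leMod _ g f
    rw [leMod_congOfTermCone, leMod_congOfTermCone]
    by_cases hf : f = 0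
    · exact Or.inl ⟨fun t _ => hf ▸ isTermBound_zero hS t, fun _ => hf⟩
    by_cases hg : g = 0
    · exact Or.inr ⟨fun t _ => hg ▸ isTermBound_zero hS t, fun _ => hg⟩
    by_cases h : ∀ t, IsTermBound hS T g t → IsTermBound hS T f t
    · exact Or.inl ⟨h, fun h' => absurd h' hg⟩
    · refine Or.inr ⟨fun t ht u hu => ?_, fun h' => absurd h' hf⟩
      push Not at h
      obtain ⟨s, hsg, hsf⟩ := h
      unfold IsTermBound at hsf
      push Not at hsf
      obtain ⟨v, hv, hvs⟩ := hsf
      -- With `v` a term of `f` not below `s`, the chain is `u - t = (u - s) + (s - v) + (v - t)`.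
      have h1 := hT.add_mem _ _ (hsg u hu)
        (hT.add_mem _ _ (hT.neg_mem_of_notMem hvs) (ht v hv))
      convert h1 using 1
      abel
  have hzero : ∀ f, (congOfTermCone hS hT).mk' f = 0 → f = 0 := by
    intro f h
    rw [← map_zero (congOfTermCone hS hT).mk', mk_eq_mk_iff] at h
    exact h.2.2 rfl
  have hne : congOfTermCone hS hT ≠ ⊤ := by
    rw [← RingCon.nontrivial_quotient]
    refine ⟨1, 0, fun h => ?_⟩
    rw [← map_one (congOfTermCone hS hT).mk'] at h
    exact one_ne_zero (hzero _ h)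
  refine ⟨hne, htotal, fun x y z hx hxyz => ?_⟩
  obtain ⟨f, rfl⟩ := (congOfTermCone hS hT).mk'_surjective x
  have hf : f ≠ 0 := fun h => hx (by rw [h, map_zero])
  obtain ⟨u, hu, h⟩ := exists_sum_eq_of_total htotal
    (s := f.coeff.support) (by simpa [Finsupp.support_nonempty_iff] using hf)
    fun u => (congOfTermCone hS hT).mk' (single u (f.coeff u))
  rw [← map_sum, sum_support_single, single_eq_term hS (Finsupp.mem_support_iff.1 hu)] at h
  have hinv := congrArg (fun q => (congOfTermCone hS hT).mk'
    (term hS (-logTerm hS (f.coeff u) u)) * q) hxyz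
  simpa only [h, ← mul_assoc, ← map_mul, mul_comm (term hS (-_)), term_mul_neg, map_one,
    one_mul] using hinv

end OfTermCone

end Congruence

/-! ### Half-spaces and evaluation -/

section HalfSpace

open AddMonoidAlgebra

variable {M : Type*} [AddCommGroup M]

/-- The preimage of the half-space `r γ + ⟨x, u⟩ ≤ 0` under `φ`. -/
def halfSpace {Γ : AddSubgroup ℝ} {X : Type*} (φ : X → ℝ≥0 × (M →+ ℝ)) (g : Γ × M) : Set X :=
  {x | pairing (φ x) g ≤ 0}

theorem mem_halfSpace {Γ : AddSubgroup ℝ} {X : Type*} {φ : X → ℝ≥0 × (M →+ ℝ)} {g : Γ × M}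
    {x : X} : x ∈ halfSpace φ g ↔ pairing (φ x) g ≤ 0 := Iff.rfl

/-- A failure of any axiom would be a set of at most three linear inequalities with no solution; the
last axiom uses `r ≥ 0`. -/
theorem isTermCone_of_isFeasible {Γ : AddSubgroup ℝ} {X : Type*} {φ : X → ℝ≥0 × (M →+ ℝ)}
    {T : Set (Γ × M)} (h : IsFeasible (halfSpace φ) T) : IsTermCone T where
  add_mem p q hp hq := by
    by_contra hpq
    obtain ⟨x, hx, hx'⟩ := h {p, q} {p + q} (by simp) (by simp)
      (by rintro _ (rfl | rfl) <;> assumption) (by simpa using hpq)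
    have h1 := mem_halfSpace.1 (hx p (by simp))
    have h2 := mem_halfSpace.1 (hx q (by simp))
    have h3 := mem_halfSpace.not.1 (hx' (p + q) (by simp))
    rw [map_add] at h3
    linarith
  total p := by
    by_contra! hp
    obtain ⟨x, -, hx⟩ := h ∅ {p, -p} (by simp) (by simp) (by simp)
      (by rintro _ (rfl | rfl); exacts [hp.1, hp.2])
    have h1 := mem_halfSpace.not.1 (hx p (by simp))
    have h2 := mem_halfSpace.not.1 (hx (-p) (by simp))
    rw [map_neg] at h2
    linarith
  nonpos_mem γ hγ := by
    by_contra hp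
    obtain ⟨x, -, hx⟩ := h ∅ {(γ, 0)} (by simp) (by simp) (by simp) (by simpa using hp)
    refine hx _ rfl ?_
    rw [mem_halfSpace, pairing_apply, map_zero, add_zero]
    exact mul_nonpos_of_nonneg_of_nonpos (φ x).1.2 hγ

variable {S : Subsemiring MaxPlus} (hS : IsSubsemifield S)

theorem homEvalAt_le_iff (f g : AddMonoidAlgebra S M) (w : ℝ≥0 × (M →+ ℝ)) :
    homEvalAt f w ≤ homEvalAt g w ↔ ∀ u ∈ f.coeff.support, ∃ v ∈ g.coeff.support,
      pairing w (logTerm hS (f.coeff u) u - logTerm hS (g.coeff v) v) ≤ 0 := by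
  have key : ∀ f : AddMonoidAlgebra S M, homEvalAt f w = f.coeff.support.sup fun u =>
      ((pairing w (logTerm hS (f.coeff u) u) : ℝ) : WithBot ℝ) := by
    intro f
    refine Finset.sup_congr rfl fun u hu => ?_
    rw [← coe_realLog (coe_ne_zero (Finsupp.mem_support_iff.1 hu))]
    rfl
  rw [key, key, Finset.sup_le_iff]
  refine forall₂_congr fun u hu => ?_
  rw [Finset.le_sup_iff (WithBot.bot_lt_coe _)]
  simp only [WithBot.coe_le_coe, map_sub, sub_nonpos]

theorem homEvalAt_single_le_iff (a b : S) (u v : M) (w : ℝ≥0 × (M →+ ℝ)) :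
    homEvalAt (single u a) w ≤ homEvalAt (single v b) w ↔
      a = 0 ∨ (b ≠ 0 ∧ pairing w (logTerm hS a u - logTerm hS b v) ≤ 0) := by
  rw [homEvalAt_le_iff hS]
  by_cases ha : a = 0
  · simp [ha]
  by_cases hb : b = 0
  · simp [ha, hb]
  simp [ha, hb, Finsupp.support_single]

theorem congTermLE_iff {P : RingCon (AddMonoidAlgebra S M)} (hP : IsPrimeCong P) (a b : S)
    (u v : M) : congTermLE P a u b v ↔
      a = 0 ∨ (b ≠ 0 ∧ logTerm hS a u - logTerm hS b v ∈ termCone hS P) := by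
  rw [congTermLE, leMod_iff hS hP]
  by_cases ha : a = 0
  · simp [ha]
  by_cases hb : b = 0
  · simp [ha, hb]
  simp [ha, hb, Finsupp.support_single]

theorem homEvalAt_term_le_one_iff (g : valueSubgroup hS × M) (w : ℝ≥0 × (M →+ ℝ)) :
    homEvalAt (term hS g) w ≤ homEvalAt (1 : AddMonoidAlgebra S M) w ↔ pairing w g ≤ 0 := by
  rw [← term_zero hS, term, term, homEvalAt_single_le_iff hS]
  simp [valueExp_ne_zero, logTerm, valueLog_valueExp, Prod.mk_zero_zero]

theorem evalAt_eq_homEvalAt (f : AddMonoidAlgebra S M) (x : M →+ ℝ) :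
    evalAt f x = homEvalAt f (1, x) := by
  simp [evalAt, homEvalAt]

variable {X : Type*} (φ : X → ℝ≥0 × (M →+ ℝ))

/-- Choosing for each term of each `f i` a term of `f₀` dominating it modulo `P` gives a cell inside
the rational set. Conversely, a cell is the rational set with `f₀ = 1` and its defining terms as the
`f i`. -/
theorem exists_ratSet_subset_iff {P : RingCon (AddMonoidAlgebra S M)} (hP : IsPrimeCong P)
    (U : Set X) :
    (∃ (n : ℕ) (f₀ : AddMonoidAlgebra S M) (f : Fin n → AddMonoidAlgebra S M),
      {x | ∀ i, homEvalAt (f i) (φ x) ≤ homEvalAt f₀ (φ x)} ⊆ U ∧ ∀ i, leMod P (f i) f₀) ↔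
    ∃ s : Set (valueSubgroup hS × M), s.Finite ∧ s ⊆ termCone hS P ∧
      {x | ∀ g ∈ s, x ∈ halfSpace φ g} ⊆ U := by
  constructor
  · rintro ⟨n, f₀, f, hU, hf⟩
    simp only [leMod_iff hS hP] at hf
    choose! v hv hvT using hf
    refine ⟨⋃ i, (fun u => logTerm hS ((f i).coeff u) u - logTerm hS (f₀.coeff (v i u)) (v i u)) ''
      (f i).coeff.support, Set.finite_iUnion fun i => (Finset.finite_toSet _).image _, ?_, ?_⟩
    · rintro g hg
      obtain ⟨i, u, hu, rfl⟩ := Set.mem_iUnion.1 hg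
      exact hvT i u hu
    · refine fun x hx => hU fun i => ?_
      rw [homEvalAt_le_iff hS]
      exact fun u hu => ⟨v i u, hv i u hu, hx _ (Set.mem_iUnion.2 ⟨i, u, hu, rfl⟩)⟩
  · rintro ⟨s, hs, hsT, hsU⟩
    let e := hs.toFinset.equivFin
    refine ⟨_, 1, fun i => term hS (e.symm i).1, fun x hx => hsU fun g hg => ?_,
      fun i => hsT (hs.mem_toFinset.1 (e.symm i).2)⟩
    have := hx (e ⟨g, hs.mem_toFinset.2 hg⟩)
    rw [homEvalAt_term_le_one_iff] at this
    simpa [mem_halfSpace] using this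

variable {φ} {L : Sublattice (Set X)}
  (hL : ∀ U, U ∈ L ↔ IsFiniteUnionOf (IsCell (halfSpace (Γ := valueSubgroup hS) φ)) U)

theorem filter_term_le_iff {F : Order.PFilter L} (hF : F.IsPrime) (a b : S) (u v : M) :
    (∃ U ∈ F, ∀ x ∈ U.1, homEvalAt (single u a) (φ x) ≤ homEvalAt (single v b) (φ x)) ↔
      a = 0 ∨ (b ≠ 0 ∧ logTerm hS a u - logTerm hS b v ∈ genSet hL F) := by
  simp only [homEvalAt_single_le_iff hS]
  by_cases ha : a = 0
  · simp only [ha, true_or, implies_true, and_true, iff_true]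
    exact F.nonempty
  by_cases hb : b = 0
  · simp only [ha, hb, ne_eq, not_true_eq_false, false_and, or_false, iff_false, not_exists]
    rintro U ⟨hU, h⟩
    obtain ⟨x, hx⟩ := nonempty_of_mem_filter hF hU
    exact h x hx
  simp only [ha, hb, ne_eq, not_false_eq_true, true_and, false_or]
  constructor
  · rintro ⟨U, hU, h⟩
    exact F.mem_of_le h hU
  · exact fun h => ⟨_, h, fun x hx => hx⟩

/-- `termCone` and `genSet` are injective on the two sides, and `hpq`, `hqp` say that they have the
same image; the bijection matches equal values. -/
theorem exists_equiv_primeFilters (p : RingCon (AddMonoidAlgebra S M) → Prop)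
    (q : Order.PFilter L → Prop) (hp : ∀ P, p P → IsPrimeCong P) (hq : ∀ F, q F → F.IsPrime)
    (hpq : ∀ P, p P → ∃ F, q F ∧ genSet hL F = termCone hS P)
    (hqp : ∀ F, q F → ∃ P, p P ∧ termCone hS P = genSet hL F) :
    ∃ e : {P // p P} ≃ {F // q F},
      (∀ P, ((e P).1 : Set L) = {U | ∃ (n : ℕ) (f₀ : AddMonoidAlgebra S M)
        (f : Fin n → AddMonoidAlgebra S M),
        {x | ∀ i, homEvalAt (f i) (φ x) ≤ homEvalAt f₀ (φ x)} ⊆ U.1 ∧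
          ∀ i, leMod P.1 (f i) f₀}) ∧
      ∀ F P, P = e.symm F ↔ ∀ (a : S) (u : M) (b : S) (v : M), congTermLE P.1 a u b v ↔
        ∃ U ∈ F.1, ∀ x ∈ U.1, homEvalAt (single u a) (φ x) ≤ homEvalAt (single v b) (φ x) := by
  choose fwd hfwd hfwd' using hpq
  have he : Function.Bijective
      (fun P : {P // p P} => (⟨fwd P.1 P.2, hfwd P.1 P.2⟩ : {F // q F})) := by
    constructor
    · intro P P' h
      have h1 : fwd P.1 P.2 = fwd P'.1 P'.2 := congrArg Subtype.val h
      exact Subtype.ext (primeCong_ext hS (hp _ P.2) (hp _ P'.2) (by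
        rw [← hfwd' _ P.2, ← hfwd' _ P'.2, h1]))
    · intro F
      obtain ⟨P, hP, hPF⟩ := hqp F.1 F.2
      exact ⟨⟨P, hP⟩, Subtype.ext (primeFilter_ext hL (hq _ (hfwd _ hP)) (hq _ F.2) (by
        rw [hfwd' _ hP, hPF]))⟩
  have hcoe : ∀ P, genSet hL (Equiv.ofBijective _ he P).1 = termCone hS P.1 :=
    fun P => hfwd' P.1 P.2
  refine ⟨Equiv.ofBijective _ he, fun P => ?_, fun F P => ?_⟩
  · ext U
    rw [SetLike.mem_coe, mem_filter_iff hL (hq _ (Equiv.ofBijective _ he P).2), hcoe]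
    exact (exists_ratSet_subset_iff hS φ (hp _ P.2) U.1).symm
  · have h1 : P = (Equiv.ofBijective _ he).symm F ↔ termCone hS P.1 = genSet hL F.1 := by
      rw [Equiv.eq_symm_apply, ← hcoe]
      exact ⟨fun h => by rw [h],
        fun h => Subtype.ext (primeFilter_ext hL (hq _ (Equiv.ofBijective _ he P).2) (hq _ F.2) h)⟩
    rw [h1]
    constructor
    · intro h a u b v
      rw [congTermLE_iff hS (hp _ P.2), filter_term_le_iff hS hL (hq _ F.2), h]
    · intro h
      ext g
      -- Comparison with the term `1` recovers both subsets of `Γ × M` from the term preorders.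
      have h2 := h (valueExp hS g.1) g.2 1 0
      rw [congTermLE_iff hS (hp _ P.2), filter_term_le_iff hS hL (hq _ F.2),
        ← valueExp_zero hS] at h2
      simpa [valueExp_ne_zero, logTerm, valueLog_valueExp, Prod.mk_zero_zero] using h2

end HalfSpace

/-! ### Fan support sets -/

section Fan

variable {M : Type*} [AddCommGroup M] {S : Subsemiring MaxPlus} (hS : IsSubsemifield S)

theorem isAdmissibleCone_iff (C : Set (ℝ≥0 × (M →+ ℝ))) : IsAdmissibleCone (valueGroup S) C ↔
    IsCell (halfSpace (Γ := valueSubgroup hS) id) C := by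
  let j : valueSubgroup hS × M → ℝ × M := fun g => (g.1, g.2)
  have hj : Function.Injective j := fun g h hgh => by
    simp only [j, Prod.mk.injEq, SetLike.coe_eq_coe] at hgh
    exact Prod.ext hgh.1 hgh.2
  constructor
  · rintro ⟨s, hs, hsΓ, rfl⟩
    refine ⟨j ⁻¹' s, hs.preimage hj.injOn, Set.ext fun w => ⟨fun h g hg => h _ hg, fun h p hp => ?_⟩⟩
    exact h (⟨p.1, hsΓ p hp⟩, p.2) hp
  · rintro ⟨s, hs, rfl⟩
    refine ⟨j '' s, hs.image j, ?_, Set.ext fun w => ⟨?_, fun h g hg => h _ ⟨g, hg, rfl⟩⟩⟩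
    · rintro _ ⟨g, hg, rfl⟩
      exact g.1.2
    · rintro h _ ⟨g, hg, rfl⟩
      exact h g hg

theorem mem_fanSupportSets_iff (U : Set (ℝ≥0 × (M →+ ℝ))) :
    U ∈ fanSupportSets (valueGroup S) M ↔
      IsFiniteUnionOf (IsCell (halfSpace (Γ := valueSubgroup hS) id)) U := by
  rw [← funext fun C => propext (isAdmissibleCone_iff hS C)]
  rfl

theorem isFeasible_of_isTermCone [Module.Free ℤ M] [Module.Finite ℤ M] {Γ : AddSubgroup ℝ}
    {T : Set (Γ × M)} (hT : IsTermCone T) : IsFeasible (halfSpace id) T := by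
  intro A B hA hB hAT hBT
  obtain ⟨w, hw⟩ := hasSeparation Γ M T hT (A ∪ B) (hA.union hB)
  exact ⟨w, fun g hg => (hw g (Or.inl hg)).1.1 (hAT hg),
    fun g hg hwg => hBT hg ((hw g (Or.inr hg)).1.2 hwg)⟩

end Fan

/-! ### Polyhedral sets and continuity -/

section Polyhedral

variable {M : Type*} [AddCommGroup M]

/-- The embedding of `N_ℝ` at height one. -/
def atOne (x : M →+ ℝ) : ℝ≥0 × (M →+ ℝ) := (1, x)

/-- Every term is strictly larger than some constant. -/
def IsBoundedTermSet {Γ : AddSubgroup ℝ} (T : Set (Γ × M)) : Prop :=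
  ∀ g : Γ × M, ∃ γ : Γ, (γ, 0) - g ∈ T ∧ g - (γ, 0) ∉ T

/-- One further strict condition on the separating point, coming from a constant strictly below `1`,
excludes height zero; scaling by `r⁻¹` preserves all signs. -/
theorem isFeasible_atOne [Module.Free ℤ M] [Module.Finite ℤ M] {Γ : AddSubgroup ℝ}
    {T : Set (Γ × M)} (hT : IsTermCone T) (hb : IsBoundedTermSet T) :
    IsFeasible (halfSpace atOne) T := by
  intro A B hA hB hAT hBT
  obtain ⟨γ, -, hγ⟩ := hb 0
  rw [zero_sub] at hγ
  obtain ⟨w, hA', hB'⟩ := isFeasible_of_isTermCone hT A (B ∪ {-(γ, 0)}) hA (hB.union (by simp)) hAT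
    (Set.union_subset hBT (by simpa using hγ))
  have hr : w.1 ≠ 0 := by
    intro h
    refine hB' _ (Or.inr rfl) ?_
    rw [mem_halfSpace, map_neg, pairing_apply]
    simp [h]
  have hr' : (0 : ℝ) < w.1 := NNReal.coe_pos.2 (pos_iff_ne_zero.2 hr)
  have key : ∀ g : Γ × M, g ∈ {g | pairing (atOne ((w.1 : ℝ)⁻¹ • w.2)) g ≤ 0} ↔ pairing w g ≤ 0 := by
    intro g
    have : pairing (atOne ((w.1 : ℝ)⁻¹ • w.2)) g = (w.1 : ℝ)⁻¹ * pairing w g := by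
      simp only [pairing_apply, atOne, NNReal.coe_one, one_mul, AddMonoidHom.smul_apply,
        smul_eq_mul]
      field_simp
    change pairing _ g ≤ 0 ↔ _
    rw [this]
    exact mul_nonpos_iff_pos_imp_nonpos.trans ⟨fun h => h.1 (inv_pos.2 hr'),
      fun h => ⟨fun _ => h, fun h' => (inv_pos.2 hr').le⟩⟩
  exact ⟨(w.1 : ℝ)⁻¹ • w.2, fun g hg => (key g).2 (hA' g hg),
    fun g hg hx => hB' g (Or.inl hg) ((key g).1 hx)⟩

variable {S : Subsemiring MaxPlus} (hS : IsSubsemifield S)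

theorem isRationalPolyhedron_iff (Q : Set (M →+ ℝ)) : IsRationalPolyhedron (valueGroup S) Q ↔
    IsCell (halfSpace (Γ := valueSubgroup hS) atOne) Q := by
  -- At height one the generator `(γ, u)` reads `γ + ⟨x, u⟩ ≤ 0`, hence the sign.
  let j : valueSubgroup hS × M → ℝ × M := fun g => (-g.1, g.2)
  have hj : Function.Injective j := fun g h hgh => by
    simp only [j, Prod.mk.injEq, neg_inj, SetLike.coe_eq_coe] at hgh
    exact Prod.ext hgh.1 hgh.2
  have hmem : ∀ (g : valueSubgroup hS × M) (x : M →+ ℝ),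
      x ∈ halfSpace atOne g ↔ x (j g).2 ≤ (j g).1 := by
    intro g x
    simp only [mem_halfSpace, pairing_apply, atOne, NNReal.coe_one, one_mul, j]
    constructor <;> intro h <;> linarith
  constructor
  · rintro ⟨s, hs, hsΓ, rfl⟩
    refine ⟨j ⁻¹' s, hs.preimage hj.injOn,
      Set.ext fun x => ⟨fun h g hg => (hmem g x).2 (h _ hg), fun h p hp => ?_⟩⟩
    have hjp : j (-⟨p.1, hsΓ p hp⟩, p.2) = p := by simp [j]
    have := (hmem (-⟨p.1, hsΓ p hp⟩, p.2) x).1 (h _ (by rw [Set.mem_preimage, hjp]; exact hp))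
    rwa [hjp] at this
  · rintro ⟨s, hs, rfl⟩
    refine ⟨j '' s, hs.image j, ?_, Set.ext fun x => ⟨?_, fun h g hg => (hmem g x).2 (h _ ⟨g, hg, rfl⟩)⟩⟩
    · rintro _ ⟨g, hg, rfl⟩
      exact (valueSubgroup hS).neg_mem g.1.2
    · rintro h _ ⟨g, hg, rfl⟩
      exact (hmem g x).1 (h g hg)

theorem mem_polyhedralSets_iff (U : Set (M →+ ℝ)) :
    U ∈ polyhedralSets (valueGroup S) M ↔
      IsFiniteUnionOf (IsCell (halfSpace (Γ := valueSubgroup hS) atOne)) U := by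
  rw [← funext fun C => propext (isRationalPolyhedron_iff hS C)]
  rfl

/-- On a polytope in `F` a term is bounded below, so a constant under that bound is strictly smaller
there. The reverse half-space misses the polytope, so it is not in `F`. -/
theorem isBoundedTermSet_genSet {F : Order.PFilter (polyhedralSets (valueGroup S) M)}
    (hF : F.IsPrime) (h : ∃ U ∈ F, IsRationalPolytope (valueGroup S) U.1) :
    IsBoundedTermSet (genSet (mem_polyhedralSets_iff hS) F) := by
  obtain ⟨U, hU, -, hb⟩ := h
  rintro ⟨γ, u⟩
  obtain ⟨B, hB⟩ := hb u
  obtain ⟨δ, hδ⟩ := exists_value_lt hS (γ - B)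
  have key : ∀ x ∈ U.1, pairing (atOne x) ((δ, 0) - (γ, u)) < 0 := by
    intro x hx
    have := abs_le.1 (hB x hx)
    simp only [map_sub, pairing_apply, atOne, NNReal.coe_one, one_mul, map_zero]
    linarith
  refine ⟨δ, F.mem_of_le (fun x hx => (key x hx).le) hU, fun hmem => ?_⟩
  obtain ⟨x, hx, hxU⟩ := nonempty_of_mem_filter hF (inf_mem_filter hmem hU)
  have h1 := mem_halfSpace.1 hx
  have h2 := key x hxU
  rw [← neg_sub, map_neg] at h1
  linarith

/-- Constants below the terms `χ^u` and `χ^(-u)`, for `u` in a finite generating set of `M`, cut out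
a polytope. -/
theorem exists_polytope_mem [Module.Finite ℤ M]
    {F : Order.PFilter (polyhedralSets (valueGroup S) M)}
    (h : IsBoundedTermSet (genSet (mem_polyhedralSets_iff hS) F)) :
    ∃ U ∈ F, IsRationalPolytope (valueGroup S) U.1 := by
  obtain ⟨G, hG⟩ := (Module.Finite.iff_addGroup_fg.1 (inferInstance : Module.Finite ℤ M)).out
  choose γ hγ _ using h
  let k : M → valueSubgroup hS × M := fun u => (γ (0, u), 0) - (0, u)
  have hs : (k '' (G : Set M) ∪ (fun u => k (-u)) '' (G : Set M)).Finite :=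
    (G.finite_toSet.image _).union (G.finite_toSet.image _)
  refine ⟨⟨_, cell_mem (mem_polyhedralSets_iff hS) hs⟩,
    (cell_mem_filter (mem_polyhedralSets_iff hS) hs).2 ?_,
    (isRationalPolyhedron_iff hS _).2 (isCell_inter hs), fun u => ?_⟩
  · rintro _ (⟨u, hu, rfl⟩ | ⟨u, hu, rfl⟩)
    exacts [hγ _, hγ _]
  · have hk : ∀ u x, x ∈ halfSpace atOne (k u) → (γ (0, u) : ℝ) ≤ x u := by
      intro u x hx
      simp only [k, mem_halfSpace, map_sub, pairing_apply, atOne, NNReal.coe_one, one_mul,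
        map_zero, AddSubgroup.coe_zero] at hx
      linarith
    have hu : u ∈ AddSubgroup.closure (G : Set M) := by rw [hG]; trivial
    induction hu using AddSubgroup.closure_induction with
    | mem u hu =>
      refine ⟨max (-γ (0, u)) (-γ (0, -u)), fun x hx => abs_le.2 ⟨?_, ?_⟩⟩
      · have h1 := hk u x (hx _ (Or.inl ⟨u, hu, rfl⟩))
        have h2 := le_max_left (-γ (0, u) : ℝ) (-γ (0, -u))
        linarith
      · have h1 := hk (-u) x (hx _ (Or.inr ⟨u, hu, rfl⟩))
        have h2 := le_max_right (-γ (0, u) : ℝ) (-γ (0, -u))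
        rw [map_neg] at h1
        linarith
    | zero => exact ⟨0, fun x _ => by simp⟩
    | add u v _ _ hu hv =>
      obtain ⟨B, hB⟩ := hu
      obtain ⟨B', hB'⟩ := hv
      refine ⟨B + B', fun x hx => ?_⟩
      rw [map_add]
      exact (abs_add_le _ _).trans (add_le_add (hB x hx) (hB' x hx))
    | neg u _ hu =>
      obtain ⟨B, hB⟩ := hu
      exact ⟨B, fun x hx => by rw [map_neg, abs_neg]; exact hB x hx⟩

end Polyhedral

/-! ### Continuity -/

section Continuity

open AddMonoidAlgebra

/-- Nonzero points are isolated, so only continuity at `0` counts. Totality of `K` makes the sets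
`{x | x < a}` directed, so they form a basis and one `a` suffices for each `c`. -/
theorem continuous_canonicalTopology_iff {K R : Type*} [CommSemiring K] [Nontrivial K]
    [CommSemiring R] (ht : ∀ x y : K, IdemLE x y ∨ IdemLE y x) {f : K → R} (hf : f 0 = 0) :
    @Continuous K R (canonicalTopology K) (canonicalTopology R) f ↔
      ∀ c : R, c ≠ 0 → ∃ a : K, a ≠ 0 ∧ ∀ s, IdemLT s a → IdemLT (f s) c := by
  have hdir : Directed (· ≥ ·) fun a : {a : K // a ≠ 0} =>
      Filter.principal {x | IdemLT x a.1} := by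
    have aux : ∀ a b : K, IdemLE a b → {x | IdemLT x a} ⊆ {x | IdemLT x b} := by
      rintro a b hab x ⟨h1, h2⟩
      refine ⟨IdemLE.trans h1 hab, ?_⟩
      rintro rfl
      exact h2 (IdemLE.antisymm h1 hab)
    intro a b
    rcases ht a.1 b.1 with h | h
    · exact ⟨a, le_rfl, Filter.principal_mono.2 (aux _ _ h)⟩
    · exact ⟨b, Filter.principal_mono.2 (aux _ _ h), le_rfl⟩
  have hne : Nonempty {a : K // a ≠ 0} := ⟨⟨1, one_ne_zero⟩⟩
  rw [canonicalTopology, canonicalTopology]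
  let := nhdsAdjoint (0 : R) (⨅ c : {c : R // c ≠ 0}, Filter.principal {x | IdemLT x c.1})
  rw [continuous_nhdsAdjoint_dom, hf, nhds_nhdsAdjoint_same, sup_eq_right.2]
  · rw [Filter.tendsto_iInf]
    simp only [Filter.tendsto_principal, Filter.Eventually, Filter.mem_iInf_of_directed hdir,
      Filter.mem_principal, Subtype.forall, Subtype.exists, exists_prop]
    rfl
  · refine le_iInf fun c => Filter.pure_le_iff.2 fun s hs => ?_
    exact hs ⟨zero_add _, c.2.symm⟩

theorem bijective_algebraMap_residueSemifield {A : Type*} [CommSemiring A] {P : RingCon A}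
    (hP : P ≠ ⊤) (hu : ∀ x : P.Quotient, x ≠ 0 → IsUnit x) :
    Function.Bijective (algebraMap P.Quotient (ResidueSemifield P)) := by
  have := RingCon.nontrivial_quotient.2 hP
  have H : nonZeroDivisors P.Quotient ≤ IsUnit.submonoid P.Quotient := fun x hx =>
    hu x (nonZeroDivisors.ne_zero hx)
  have h := (IsLocalization.atUnits P.Quotient (nonZeroDivisors P.Quotient)
    (S := ResidueSemifield P) H).bijective
  convert h using 1
  ext x
  exact ((IsLocalization.atUnits P.Quotient (nonZeroDivisors P.Quotient)
    (S := ResidueSemifield P) H).commutes x).symm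

/-- Continuity of `K → κ(P)` when `A / P` is already a semifield. -/
theorem continuous_residueMap_iff {K A : Type*} [CommSemiring K] [Nontrivial K] [CommSemiring A]
    [Algebra K A] (ht : ∀ x y : K, IdemLE x y ∨ IdemLE y x) {P : RingCon A}
    (hP : P ≠ ⊤) (hu : ∀ x : P.Quotient, x ≠ 0 → IsUnit x) :
    (@Continuous K (ResidueSemifield P) (canonicalTopology K)
      (canonicalTopology (ResidueSemifield P)) (fun a => residueMap P (algebraMap K A a))) ↔
      ∀ x : P.Quotient, x ≠ 0 →
        ∃ a : K, a ≠ 0 ∧ ∀ s, IdemLT s a → IdemLT (P.mk' (algebraMap K A s)) x := by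
  have hbij := bijective_algebraMap_residueSemifield hP hu
  rw [continuous_canonicalTopology_iff ht (by simp), hbij.2.forall]
  refine forall_congr' fun x => ?_
  rw [← map_zero (algebraMap P.Quotient (ResidueSemifield P)), hbij.1.ne_iff]
  refine imp_congr_right fun _ => exists_congr fun a => and_congr_right fun _ =>
    forall₂_congr fun s _ => ?_
  change algebraMap P.Quotient (ResidueSemifield P) _ + _ = _ ∧
    algebraMap P.Quotient (ResidueSemifield P) _ ≠ _ ↔ _
  rw [← map_add, hbij.1.eq_iff, hbij.1.ne_iff]
  rfl

theorem isCont_iff_forall {K A : Type*} [CommSemiring K] [Nontrivial K] [CommSemiring A]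
    [Algebra K A] (ht : ∀ x y : K, IdemLE x y ∨ IdemLE y x) {P : RingCon A}
    (hP : IsPrimeCong P) (hu : ∀ x : P.Quotient, x ≠ 0 → IsUnit x) :
    IsCont K P ↔ Infinite P.Quotient ∧ ∀ x : P.Quotient, x ≠ 0 →
      ∃ a : K, a ≠ 0 ∧ ∀ s, IdemLT s a → IdemLT (P.mk' (algebraMap K A s)) x := by
  rw [← continuous_residueMap_iff ht hP.ne_top hu]
  exact ⟨fun h => ⟨h.infinite, h.continuous⟩, fun h => ⟨hP, h.1, h.2⟩⟩

variable {M : Type*} [AddCommGroup M] {S : Subsemiring MaxPlus} (hS : IsSubsemifield S)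
  {P : RingCon (AddMonoidAlgebra S M)}

include hS in
theorem subsemiring_total (x y : S) : IdemLE x y ∨ IdemLE y x := by
  by_cases hx : x = 0
  · exact Or.inl (by rw [hx]; exact zero_add y)
  by_cases hy : y = 0
  · exact Or.inr (by rw [hy]; exact zero_add x)
  unfold IdemLE
  rw [subsemiring_add_eq_right_iff hS hx hy, subsemiring_add_eq_right_iff hS hy hx]
  exact le_total _ _

theorem idemLT_mk_term_iff (g h : valueSubgroup hS × M) :
    IdemLT (P.mk' (term hS g)) (P.mk' (term hS h)) ↔
      g - h ∈ termCone hS P ∧ h - g ∉ termCone hS P := by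
  rw [← leMod_term_iff, ← leMod_term_iff]
  refine and_congr_right fun h1 => not_congr ⟨fun h2 => ?_, fun h2 => mk_eq_of_leMod h1 h2⟩
  rw [leMod, h2]
  exact quotient_add_self P _

-- Since `A / P` is a semifield, it is its own `κ(P)`, and its nonzero elements are classes of
-- terms. Continuity then asks for a constant strictly below each term, smaller constants following
-- from `nonpos_mem`. Infinitude of the quotient comes for free.
include hS in
theorem isCont_iff : IsCont S P ↔ IsPrimeCong P ∧ IsBoundedTermSet (termCone hS P) := by
  rw [← and_iff_right_of_imp (fun h : IsCont S P => h.prime)]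
  refine and_congr_right fun hP => ?_
  have hT := isTermCone_termCone hS hP
  have hu : ∀ x : P.Quotient, x ≠ 0 → IsUnit x := by
    intro x hx
    obtain ⟨g, rfl⟩ := exists_eq_mk_term hS hP hx
    exact (IsUnit.of_mul_eq_one _ (term_mul_neg hS g)).map P.mk'
  have hcont : (∀ x : P.Quotient, x ≠ 0 → ∃ a : S, a ≠ 0 ∧
      ∀ s, IdemLT s a → IdemLT (P.mk' (algebraMap S _ s)) x) ↔
      IsBoundedTermSet (termCone hS P) := by
    have halg : ∀ s : S, s ≠ 0 → algebraMap S (AddMonoidAlgebra S M) s =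
        term hS (valueLog hS s, 0) := by
      intro s hs
      change single 0 s = _
      rw [single_eq_term hS hs]
      rfl
    constructor
    · intro h g
      obtain ⟨a, ha, hsa⟩ := h (P.mk' (term hS g)) (mk_term_ne_zero hS hP g)
      obtain ⟨γ, hγ⟩ := exists_value_lt hS (valueLog hS a)
      refine ⟨γ, ?_⟩
      have h1 := hsa (valueExp hS γ) ⟨?_, ?_⟩
      · rw [halg _ (valueExp_ne_zero hS _)] at h1
        exact (idemLT_mk_term_iff hS _ _).1 h1
      · rw [subsemiring_add_eq_right_iff hS (valueExp_ne_zero hS _) ha]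
        exact hγ.le
      · intro h0
        rw [← h0] at hγ
        exact lt_irrefl _ hγ
    · intro h c hc
      obtain ⟨g, rfl⟩ := exists_eq_mk_term hS hP hc
      obtain ⟨γ, hγ, hγ'⟩ := h g
      refine ⟨valueExp hS γ, valueExp_ne_zero hS γ, fun s hs => ?_⟩
      by_cases hs0 : s = 0
      · rw [hs0, map_zero, map_zero]
        exact ⟨zero_add _, hc.symm⟩
      · rw [halg s hs0]
        refine (idemLT_mk_term_iff hS _ _).2 ?_
        have hle := (subsemiring_add_eq_right_iff hS hs0 (valueExp_ne_zero hS γ)).1 hs.1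
        have h0 := hT.nonpos_mem (valueLog hS s - γ) (by
          rw [AddSubgroup.coe_sub, sub_nonpos]
          exact hle)
        constructor
        · convert hT.add_mem _ _ h0 hγ using 1
          ext <;> simp
        · intro h1
          refine hγ' ?_
          convert hT.add_mem _ _ h0 h1 using 1
          ext <;> simp
  refine (isCont_iff_forall (subsemiring_total hS) hP hu).trans
    ⟨fun h => hcont.1 h.2, fun h => ⟨?_, hcont.2 h⟩⟩
  -- This constant is strictly below `1`. Two equal powers of it would put a positive multiple of
  -- `-(γ, 0)` in the cone, hence `-(γ, 0)` itself by saturation.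
  obtain ⟨γ, -, hγ⟩ := h 0
  rw [zero_sub] at hγ
  refine Infinite.of_injective
    (fun n : ℕ => P.mk' (term hS (n • ((γ, 0) : valueSubgroup hS × M)))) ?_
  refine Function.injective_iff_pairwise_ne.2 (Pairwise.of_lt ?_)
  intro n m hnm heq
  refine hγ ?_
  have h1 : leMod P (term hS (n • ((γ, 0) : valueSubgroup hS × M))) (term hS (m • (γ, 0))) := by
    rw [leMod, show P.mk' _ = P.mk' _ from heq]
    exact quotient_add_self P _
  rw [leMod_term_iff] at h1
  obtain ⟨k, rfl⟩ := Nat.exists_eq_add_of_lt hnm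
  refine hT.of_nsmul_mem (n := k + 1) (by omega) ?_
  convert h1 using 1
  rw [add_assoc, add_nsmul _ n, sub_add_cancel_left, smul_neg]

end Continuity

end TropFilter

/-! ### The two bijections. -/

theorem theoremD {M : Type*} [AddCommGroup M] [Module.Free ℤ M] [Module.Finite ℤ M]
    (S : Subsemiring TropFilter.MaxPlus) (hS : TropFilter.IsSubsemifield S) :
    (∃ e : {P : RingCon (AddMonoidAlgebra S M) // TropFilter.IsPrimeCong P} ≃
        {F : Order.PFilter (TropFilter.fanSupportSets (TropFilter.valueGroup S) M) // F.IsPrime},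
      (∀ P, ((e P).1 : Set (TropFilter.fanSupportSets (TropFilter.valueGroup S) M)) =
        TropFilter.fanFilter P.1) ∧
      (∀ F P, P = e.symm F ↔ ∀ (a : S) (u : M) (b : S) (v : M),
        TropFilter.congTermLE P.1 a u b v ↔ TropFilter.fanTermLE F.1 a u b v)) ∧
    (∃ e : {P : RingCon (AddMonoidAlgebra S M) // TropFilter.IsCont S P} ≃
        {F : Order.PFilter (TropFilter.polyhedralSets (TropFilter.valueGroup S) M) //
          F.IsPrime ∧ ∃ U ∈ F, TropFilter.IsRationalPolytope (TropFilter.valueGroup S) U.1},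
      (∀ P, ((e P).1 : Set (TropFilter.polyhedralSets (TropFilter.valueGroup S) M)) =
        TropFilter.polyhedralFilter P.1) ∧
      (∀ F P, P = e.symm F ↔ ∀ (a : S) (u : M) (b : S) (v : M),
        TropFilter.congTermLE P.1 a u b v ↔ TropFilter.polyhedralTermLE F.1 a u b v)) := by
  open TropFilter in
  constructor
  · obtain ⟨e, he, he'⟩ := exists_equiv_primeFilters hS (mem_fanSupportSets_iff (M := M) hS)
      (fun P => IsPrimeCong P) (fun F => F.IsPrime) (fun _ h => h) (fun _ h => h)
      (fun P hP => exists_primeFilter _ (isFeasible_of_isTermCone (isTermCone_termCone hS hP)))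
      (fun F hF => by
        have hT := isTermCone_of_isFeasible (isFeasible_genSet (mem_fanSupportSets_iff hS) hF)
        exact ⟨congOfTermCone hS hT, isPrimeCong_congOfTermCone hS hT,
          termCone_congOfTermCone hS hT⟩)
    exact ⟨e, he, he'⟩
  · obtain ⟨e, he, he'⟩ := exists_equiv_primeFilters hS (mem_polyhedralSets_iff (M := M) hS)
      (fun P => IsCont S P)
      (fun F => F.IsPrime ∧ ∃ U ∈ F, IsRationalPolytope (valueGroup S) U.1)
      (fun P hP => hP.prime) (fun F hF => hF.1)
      (fun P hP => by
        obtain ⟨hP, hb⟩ := (isCont_iff hS).1 hP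
        obtain ⟨F, hF, h⟩ := exists_primeFilter (mem_polyhedralSets_iff hS)
          (isFeasible_atOne (isTermCone_termCone hS hP) hb)
        exact ⟨F, ⟨hF, exists_polytope_mem hS (by rwa [h])⟩, h⟩)
      (fun F hF => by
        have hT := isTermCone_of_isFeasible
          (isFeasible_genSet (mem_polyhedralSets_iff hS) hF.1)
        have h := termCone_congOfTermCone hS hT
        refine ⟨congOfTermCone hS hT, (isCont_iff hS).2 ⟨isPrimeCong_congOfTermCone hS hT, ?_⟩, h⟩
        rw [h]
        exact isBoundedTermSet_genSet hS hF.1 hF.2)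
    refine ⟨e, fun P => ?_, fun F P => ?_⟩
    · rw [he P]
      simp only [polyhedralFilter, ratSet, evalAt_eq_homEvalAt]
      rfl
    · rw [he' F P]
      simp only [polyhedralTermLE, evalAt_eq_homEvalAt]
      rfl
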